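/- Consider the two-user fading Gaussian multiple access channel with noise variance $\sigma^2>0$, average power budgets $\bar P_1,\bar P_2>0$, and channel gains $\mathbf h=(h_1,h_2)$, $h_i\ge 0$, known to everybody and having a joint probability density $f$ with $E[\log(1+h_i)]<\infty$ for $i=1,2$ (for instance bounded gains). Let $\mathcal F_i$ be the set of measurable $\mathcal P_i(\mathbf h)\ge 0$ with $E[\mathcal P_i]\le\bar P_i$, and let $C(x)=\tfrac12\log_2(1+x)$. The capacity region $\mathcal G_c$ is the union, over $\mathcal P_1\in\mathcal F_1$ and $\mathcal P_2\in\mathcal F_2$, of the sets of pairs $(R_1,R_2)$ with $$R_1,R_2\ge 0,\quad R_i\le E\Big[C\Big(\frac{\mathcal P_ih_i}{\sigma^2}\Big)\Big]\ (i=1,2),\quad R_1+R_2\le E\Big[C\Big(\frac{\mathcal P_1h_1+\mathcal P_2h_2}{\sigma^2}\Big)\Big].$$ Let $CR_1$ be the rate pair at which user 1 water-fills over the noise, user 2 water-fills over the noise plus the interference of user 1 (both using their full budgets), and user 2 is decoded first in every state, that is, $$\mathcal P_1=\Big(\lambda_1-\frac{\sigma^2}{h_1}\Big)^+,\quad \mathcal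 P_2=\Big(\lambda_2-\frac{\sigma^2+\mathcal P_1h_1}{h_2}\Big)^+,\quad E[\mathcal P_i]=\bar P_i,\quad CR_1=\Big(E\Big[C\Big(\frac{\mathcal P_1h_1}{\sigma^2}\Big)\Big],\,E\Big[C\Big(\frac{\mathcal P_2h_2}{\sigma^2+\mathcal P_1h_1}\Big)\Big]\Big).$$ Let $CR_2$ be the pair obtained by exchanging the roles of the users, and let $SP$ be the point of $\mathcal G_c$ of maximal sum rate $R_1+R_2$. For a measurable set $D_1$ of fading states (chosen by the base-station, which decodes user 1 first on $D_1$ and user 2 first on $D_1^c$), the users play the game with strategy sets $\mathcal F_1,\mathcal F_2$ and payoffs $$\bar R_1(D_1,\mathcal P_1,\mathcal P_2)=E\Big[C\Big(\frac{\mathcal P_1h_1}{\sigma^2+\mathcal P_2h_2I_{\{\mathbf h\in D_1\}}}\Big)\Big],\qquad \bar R_2(D_1,\mathcal P_1,\mathcal P_2)=E\Big[C\Big(\frac{\mathcal P_2h_2}{\sigma^2+\mathcal P_1h_1I_{\{\mathbf h\in D_1^c\}}}\Big)\Big].$$ A Nash equilibrium is admissible if no other Nash equilibrium (for the same $D_1$)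 gives both users at least as large a payoff and at least one of them a strictly larger one. Let $\mathcal G_s$ be the set of all payoff pairs $(\bar R_1,\bar R_2)$ at admissible Nash equilibria, over all $D_1$. Then the points $CR_1$, $CR_2$, $SP$ are well defined (each exists and is unique) and lie on the boundary of $\mathcal G_c$; the set $\mathcal G_s$ contains $CR_1$, $CR_2$ and $SP$; and $\mathcal G_s$ contains no other boundary point of $\mathcal G_c$. -/

import Mathlib

open MeasureTheory Set

noncomputable section

/-- A two-user flat-fading Gaussian multiple access channel with full channel state information.
A fading state is `h = (h₁, h₂)`, a pair of (power) gains with joint density `f`. -/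
structure FadingMAC where
  /-- standard deviation of the Gaussian noise -/
  σ : ℝ
  σ_pos : 0 < σ
  /-- average power budgets of user 1 and user 2 -/
  Pbar₁ : ℝ
  Pbar₂ : ℝ
  Pbar₁_pos : 0 < Pbar₁
  Pbar₂_pos : 0 < Pbar₂
  /-- joint density of the channel gains -/
  f : ℝ × ℝ → ℝ
  f_measurable : Measurable f
  f_nonneg : ∀ h, 0 ≤ f h
  f_total : ∫⁻ h, ENNReal.ofReal (f h) = 1
  /-- the gains are nonnegative -/
  f_supp : ∀ h : ℝ × ℝ, h.1 < 0 ∨ h.2 < 0 → f h = 0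
  /-- `E[log (1 + hᵢ)] < ∞`: all ergodic rates are finite (automatic for bounded gains) -/
  log_gain₁ : Integrable (fun h : ℝ × ℝ => Real.log (1 + h.1))
    (volume.withDensity fun h => ENNReal.ofReal (f h))
  log_gain₂ : Integrable (fun h : ℝ × ℝ => Real.log (1 + h.2))
    (volume.withDensity fun h => ENNReal.ofReal (f h))

namespace FadingMAC

/-- Stationary law of the fading state, `f(h₁,h₂) dh₁ dh₂`. -/
def law (M : FadingMAC) : Measure (ℝ × ℝ) :=
  volume.withDensity fun h => ENNReal.ofReal (M.f h)

/-- Rate in bits per real channel use at signal-to-noise ratio `x`. -/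
def gaussRate (x : ℝ) : ℝ := 1 / 2 * Real.logb 2 (1 + x)

/-- Power control policies meeting the average power budget `Pbar`. -/
def feasible (M : FadingMAC) (Pbar : ℝ) : Set (ℝ × ℝ → ℝ) :=
  {P | Measurable P ∧ (∀ h, 0 ≤ P h) ∧ Integrable P M.law ∧ ∫ h, P h ∂M.law ≤ Pbar}

/-! ### The capacity region -/

/-- The rate pairs (averaged pentagon) supported by a fixed pair of power control policies. -/
def pentagon (M : FadingMAC) (P₁ P₂ : ℝ × ℝ → ℝ) : Set (ℝ × ℝ) :=
  {R | 0 ≤ R.1 ∧ 0 ≤ R.2 ∧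
    R.1 ≤ ∫ h, gaussRate (P₁ h * h.1 / M.σ ^ 2) ∂M.law ∧
    R.2 ≤ ∫ h, gaussRate (P₂ h * h.2 / M.σ ^ 2) ∂M.law ∧
    R.1 + R.2 ≤ ∫ h, gaussRate ((P₁ h * h.1 + P₂ h * h.2) / M.σ ^ 2) ∂M.law}

/-- The capacity region of the fading channel with state information at both ends: the union of
the averaged pentagons over all feasible power control policies. -/
def capacityRegion (M : FadingMAC) : Set (ℝ × ℝ) :=
  {R | ∃ P₁ ∈ M.feasible M.Pbar₁, ∃ P₂ ∈ M.feasible M.Pbar₂, R ∈ M.pentagon P₁ P₂}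

/-! ### The low level game, for a fixed set `D` of states in which user 1 is decoded first -/

/-- Payoff of user 1: it sees the interference of user 2 exactly in the states of `D`. -/
def payoff₁ (M : FadingMAC) (D : Set (ℝ × ℝ)) (P₁ P₂ : ℝ × ℝ → ℝ) : ℝ :=
  ∫ h, gaussRate (P₁ h * h.1 / (M.σ ^ 2 + D.indicator (fun x => P₂ x * x.2) h)) ∂M.law

/-- Payoff of user 2: it sees the interference of user 1 exactly in the states outside `D`. -/
def payoff₂ (M : FadingMAC) (D : Set (ℝ × ℝ)) (P₁ P₂ : ℝ × ℝ → ℝ) : ℝ :=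
  ∫ h, gaussRate (P₂ h * h.2 / (M.σ ^ 2 + Dᶜ.indicator (fun x => P₁ x * x.1) h)) ∂M.law

def ratePair (M : FadingMAC) (D : Set (ℝ × ℝ)) (P₁ P₂ : ℝ × ℝ → ℝ) : ℝ × ℝ :=
  (M.payoff₁ D P₁ P₂, M.payoff₂ D P₁ P₂)

/-- `(P₁, P₂)` is a (pure) Nash equilibrium of the low level game. -/
def IsNash (M : FadingMAC) (D : Set (ℝ × ℝ)) (P₁ P₂ : ℝ × ℝ → ℝ) : Prop :=
  P₁ ∈ M.feasible M.Pbar₁ ∧ P₂ ∈ M.feasible M.Pbar₂ ∧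
    (∀ Q₁ ∈ M.feasible M.Pbar₁, M.payoff₁ D Q₁ P₂ ≤ M.payoff₁ D P₁ P₂) ∧
    (∀ Q₂ ∈ M.feasible M.Pbar₂, M.payoff₂ D P₁ Q₂ ≤ M.payoff₂ D P₁ P₂)

/-- A Nash equilibrium is admissible if no other one is at least as good for both users and
strictly better for at least one of them. -/
def IsAdmissibleNash (M : FadingMAC) (D : Set (ℝ × ℝ)) (P₁ P₂ : ℝ × ℝ → ℝ) : Prop :=
  M.IsNash D P₁ P₂ ∧
    ¬ ∃ Q₁ Q₂, M.IsNash D Q₁ Q₂ ∧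
      M.payoff₁ D P₁ P₂ ≤ M.payoff₁ D Q₁ Q₂ ∧ M.payoff₂ D P₁ P₂ ≤ M.payoff₂ D Q₁ Q₂ ∧
      (M.payoff₁ D P₁ P₂ < M.payoff₁ D Q₁ Q₂ ∨ M.payoff₂ D P₁ P₂ < M.payoff₂ D Q₁ Q₂)

/-- Rate pairs achieved at admissible Nash equilibria, over all strategies `D` of the
base-station. -/
def stackelbergRegion (M : FadingMAC) : Set (ℝ × ℝ) :=
  {R | ∃ D, MeasurableSet D ∧ ∃ P₁ P₂, M.IsAdmissibleNash D P₁ P₂ ∧ R = M.ratePair D P₁ P₂}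

/-! ### The three distinguished points -/

/-- Power allocated in a state with gain `g`, noise plus interference `N` and water level `l`:
`(l - N / g)⁺`, which is `0` at zero gain. -/
def waterFill (N g l : ℝ) : ℝ := if 0 < g then max (l - N / g) 0 else 0

/-- `R` is the rate pair of the following policy: user 1 water-fills over the noise, user 2
water-fills over the noise plus the interference from user 1, both with full power, and user 2 is
decoded first in every state. -/
def IsCornerPoint₁ (M : FadingMAC) (R : ℝ × ℝ) : Prop :=
  ∃ (l₁ l₂ : ℝ) (P₁ P₂ : ℝ × ℝ → ℝ),
    (∀ h, P₁ h = waterFill (M.σ ^ 2) h.1 l₁) ∧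
    (∀ h, P₂ h = waterFill (M.σ ^ 2 + P₁ h * h.1) h.2 l₂) ∧
    ∫ h, P₁ h ∂M.law = M.Pbar₁ ∧ ∫ h, P₂ h ∂M.law = M.Pbar₂ ∧
    R = (∫ h, gaussRate (P₁ h * h.1 / M.σ ^ 2) ∂M.law,
         ∫ h, gaussRate (P₂ h * h.2 / (M.σ ^ 2 + P₁ h * h.1)) ∂M.law)

/-- The same with the roles of the users exchanged. -/
def IsCornerPoint₂ (M : FadingMAC) (R : ℝ × ℝ) : Prop :=
  ∃ (l₁ l₂ : ℝ) (P₁ P₂ : ℝ × ℝ → ℝ),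
    (∀ h, P₂ h = waterFill (M.σ ^ 2) h.2 l₂) ∧
    (∀ h, P₁ h = waterFill (M.σ ^ 2 + P₂ h * h.2) h.1 l₁) ∧
    ∫ h, P₁ h ∂M.law = M.Pbar₁ ∧ ∫ h, P₂ h ∂M.law = M.Pbar₂ ∧
    R = (∫ h, gaussRate (P₁ h * h.1 / (M.σ ^ 2 + P₂ h * h.2)) ∂M.law,
         ∫ h, gaussRate (P₂ h * h.2 / M.σ ^ 2) ∂M.law)

/-- `R` maximizes the sum rate over the capacity region. -/
def IsSumRatePoint (M : FadingMAC) (R : ℝ × ℝ) : Prop :=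
  R ∈ M.capacityRegion ∧ ∀ S ∈ M.capacityRegion, S.1 + S.2 ≤ R.1 + R.2

end FadingMAC

end

open Filter Topology
open FadingMAC

namespace FadingMAC

/-! ### Scalar rate function -/

/-! Against fixed interference the rate is strictly concave in the power, so a user has one best
response up to null sets: water-filling over noise plus interference (`bestResponse_iff`).
Successive decoding splits the sum rate exactly, so for every `D` the two payoffs add up to
`sumRate` (`payoff_add_payoff`).

Corner points. If `D = ∅`, user 1 sees no interference and must water-fill over the noise; user 2
then has a forced reply. All equilibria thus share one payoff pair, which is `CR₁` and maximizes the
first rate over the region. `CR₂` follows by exchanging the users.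

Sum-rate point. The gains have a density, so `l₁ g₁ = l₂ g₂` is a null event and the optimal sum
rate lets only the user with the larger `lᵢ gᵢ` transmit. Levels meeting both budgets come from
minimizing the Lagrangian dual (`exists_exclusive_levels`). Decoding the silent user first makes
this policy an equilibrium; an equilibrium dominating it would exceed the maximal sum rate, so it is
admissible.

Nothing else on the boundary. The region is convex and equilibrium payoffs are positive, so a
boundary payoff maximizes some `α R₁ + β R₂` with `α, β ≥ 0`, not both zero. If `α = β` it is the
sum-rate point; by symmetry let `α > β` (`isCorner_or_isSumPoint`). Replacing `D` by `∅` keeps the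
sum and cannot lower the first rate, so user 1 already suffers no loss from interference and
water-fills over the bare noise. If `β = 0` this is `CR₁`. If `β > 0`, a first-order condition
(`marginal_const`) makes the marginal sum rate `g₁ / (N + P₁ g₁ + P₂ g₂)` constant where user 1
transmits. Where both transmit the denominator is `l₂ g₂`, so `g₁ / g₂` is constant there, a null
event. Transmission is therefore exclusive and the water-filling conditions become the optimality
conditions of the sum rate. -/

theorem gaussRate_eq (x : ℝ) : gaussRate x = (2 * Real.log 2)⁻¹ * Real.log (1 + x) := by
  unfold gaussRate Real.logb
  field_simp

theorem rateScale_pos : 0 < (2 * Real.log 2)⁻¹ := by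
  have := Real.log_pos one_lt_two
  positivity

@[simp] theorem gaussRate_zero : gaussRate 0 = 0 := by simp [gaussRate]

theorem gaussRate_nonneg {x : ℝ} (hx : 0 ≤ x) : 0 ≤ gaussRate x := by
  rw [gaussRate_eq]
  exact mul_nonneg rateScale_pos.le (Real.log_nonneg (by linarith))

theorem gaussRate_lt {x y : ℝ} (hx : 0 ≤ x) (hxy : x < y) : gaussRate x < gaussRate y := by
  rw [gaussRate_eq, gaussRate_eq]
  exact mul_lt_mul_of_pos_left (Real.log_lt_log (by linarith) (by linarith)) rateScale_pos

theorem gaussRate_le {x y : ℝ} (hx : 0 ≤ x) (hxy : x ≤ y) : gaussRate x ≤ gaussRate y := by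
  rcases hxy.eq_or_lt with rfl | h
  · rfl
  · exact (gaussRate_lt hx h).le

/-- Tangent-line bound for the concave rate, from `log u < u - 1` at `u = (N + y) / (N + x)`. Its
strictness is the source of all uniqueness statements. -/
theorem gaussRate_sub_lt {N x y : ℝ} (hN : 0 < N) (hx : 0 ≤ x) (hy : 0 ≤ y) (hne : y ≠ x) :
    gaussRate (y / N) - gaussRate (x / N) < (2 * Real.log 2)⁻¹ * ((y - x) / (N + x)) := by
  have h1 : 1 + y / N = (N + y) / N := by field_simp
  have h2 : 1 + x / N = (N + x) / N := by field_simp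
  have hNx : 0 < N + x := by linarith
  have hNy : 0 < N + y := by linarith
  rw [gaussRate_eq, gaussRate_eq, ← mul_sub, h1, h2, ← Real.log_div (by positivity) (by positivity)]
  apply mul_lt_mul_of_pos_left _ rateScale_pos
  have h3 : (N + y) / N / ((N + x) / N) = (N + y) / (N + x) := by field_simp
  rw [h3]
  have h4 := Real.log_lt_sub_one_of_pos (x := (N + y) / (N + x)) (by positivity) (by
    intro h
    rw [div_eq_one_iff_eq hNx.ne'] at h
    exact hne (by linarith))
  refine h4.trans_eq ?_
  field_simp
  ring

theorem gaussRate_sub_le {N x y : ℝ} (hN : 0 < N) (hx : 0 ≤ x) (hy : 0 ≤ y) :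
    gaussRate (y / N) - gaussRate (x / N) ≤ (2 * Real.log 2)⁻¹ * ((y - x) / (N + x)) := by
  by_cases h : y = x
  · simp [h]
  · exact (gaussRate_sub_lt hN hx hy h).le

/-- Successive decoding achieves the sum rate. -/
theorem gaussRate_successive {N x y : ℝ} (hN : 0 < N) (hx : 0 ≤ x) (hy : 0 ≤ y) :
    gaussRate (x / (N + y)) + gaussRate (y / N) = gaussRate ((x + y) / N) := by
  rw [gaussRate_eq, gaussRate_eq, gaussRate_eq, ← mul_add,
    ← Real.log_mul (by positivity) (by positivity)]
  congr 2
  field_simp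
  ring

theorem gaussRate_add_le {x y : ℝ} (hx : 0 ≤ x) (hy : 0 ≤ y) :
    gaussRate (x + y) ≤ gaussRate x + gaussRate y := by
  rw [gaussRate_eq, gaussRate_eq, gaussRate_eq, ← mul_add,
    ← Real.log_mul (by positivity) (by positivity)]
  apply mul_le_mul_of_nonneg_left _ rateScale_pos.le
  apply Real.log_le_log (by positivity)
  nlinarith [mul_nonneg hx hy]

theorem gaussRate_concave {x y s t : ℝ} (hx : 0 ≤ x) (hy : 0 ≤ y) (hs : 0 ≤ s) (ht : 0 ≤ t)
    (hst : s + t = 1) : s * gaussRate x + t * gaussRate y ≤ gaussRate (s * x + t * y) := by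
  have h := strictConcaveOn_log_Ioi.concaveOn.2 (x := 1 + x) (y := 1 + y)
    (by simp only [mem_Ioi]; linarith) (by simp only [mem_Ioi]; linarith) hs ht hst
  simp only [smul_eq_mul] at h
  have h2 : s * (1 + x) + t * (1 + y) = 1 + (s * x + t * y) := by linear_combination hst
  rw [h2] at h
  rw [gaussRate_eq, gaussRate_eq, gaussRate_eq]
  nlinarith [mul_le_mul_of_nonneg_left h rateScale_pos.le]

@[fun_prop]
theorem measurable_gaussRate : Measurable gaussRate := by
  unfold gaussRate Real.logb
  fun_prop

/-- `1 + q g ≤ (1 + q)(1 + g)` separates power from gain, so integrable power and an integrable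
log-gain suffice for a finite rate. -/
theorem gaussRate_mul_le {q g : ℝ} (hq : 0 ≤ q) (hg : 0 ≤ g) :
    gaussRate (q * g) ≤ (2 * Real.log 2)⁻¹ * (q + Real.log (1 + g)) := by
  rw [gaussRate_eq]
  apply mul_le_mul_of_nonneg_left _ rateScale_pos.le
  have h1 : Real.log (1 + q * g) ≤ Real.log ((1 + q) * (1 + g)) :=
    Real.log_le_log (by positivity) (by nlinarith)
  rw [Real.log_mul (by positivity) (by positivity)] at h1
  have h2 := Real.log_le_sub_one_of_pos (x := 1 + q) (by positivity)
  linarith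

/-! ### Single-user water-filling -/

theorem waterFill_nonneg (N g l : ℝ) : 0 ≤ waterFill N g l := by
  unfold waterFill
  split_ifs
  · exact le_max_right _ _
  · exact le_rfl

theorem waterFill_le {N g l : ℝ} (hN : 0 ≤ N) (hl : 0 ≤ l) : waterFill N g l ≤ l := by
  unfold waterFill
  split_ifs with h
  · exact max_le (by have := div_nonneg hN h.le; linarith) hl
  · exact hl

theorem level_le_of_waterFill {N g l : ℝ} (hg : 0 < g) :
    l * g ≤ N + waterFill N g l * g := by
  have h : l - N / g ≤ waterFill N g l := by
    rw [waterFill, if_pos hg]; exact le_max_left _ _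
  have := mul_le_mul_of_nonneg_right h hg.le
  rw [sub_mul, div_mul_cancel₀ _ hg.ne'] at this
  linarith

theorem level_eq_of_waterFill_pos {N g l : ℝ} (hg : 0 < g) (h : 0 < waterFill N g l) :
    N + waterFill N g l * g = l * g := by
  rw [waterFill, if_pos hg] at h ⊢
  rcases le_total (l - N / g) 0 with h0 | h0
  · rw [max_eq_right h0] at h; exact absurd h (lt_irrefl _)
  · rw [max_eq_left h0, sub_mul, div_mul_cancel₀ _ hg.ne']; ring

/-- Water-filling is characterised by its complementary slackness conditions. -/
theorem eq_waterFill {N g l p : ℝ} (hg : 0 < g) (hp : 0 ≤ p) (h1 : l * g ≤ N + p * g)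
    (h2 : 0 < p → N + p * g = l * g) : p = waterFill N g l := by
  rw [waterFill, if_pos hg]
  have hN : N / g * g = N := div_mul_cancel₀ _ hg.ne'
  rcases hp.eq_or_lt with rfl | hp
  · rw [max_eq_right]
    rw [sub_nonpos, le_div_iff₀ hg]
    linarith
  · have h3 : p = l - N / g := by
      apply mul_right_cancel₀ hg.ne'
      rw [sub_mul, hN]
      linarith [h2 hp]
    rw [← h3, max_eq_left hp.le]

@[fun_prop]
theorem measurable_waterFill {Ω : Type*} [MeasurableSpace Ω] {n g : Ω → ℝ} (hn : Measurable n)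
    (hg : Measurable g) (l : ℝ) : Measurable fun x => waterFill (n x) (g x) l := by
  unfold waterFill
  exact Measurable.ite (measurableSet_lt measurable_const hg) (by fun_prop) measurable_const

/-- The marginal rate at the water-filling power is `1 / l` where that power is positive and at most
`1 / l` where it vanishes; concavity does the rest. Here `1 / l` is the price of power. -/
theorem gaussRate_waterFill_le {N g l q : ℝ} (hN : 0 < N) (hg : 0 < g) (hl : 0 < l) (hq : 0 ≤ q) :
    gaussRate (q * g / N) - gaussRate (waterFill N g l * g / N)
      ≤ (2 * Real.log 2)⁻¹ * ((q - waterFill N g l) / l) := by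
  have hp := waterFill_nonneg N g l
  refine (gaussRate_sub_le hN (by positivity) (by positivity)).trans
    (mul_le_mul_of_nonneg_left ?_ rateScale_pos.le)
  have h1 := level_le_of_waterFill (N := N) (l := l) hg
  rw [div_le_div_iff₀ (by positivity) hl]
  rcases hp.eq_or_lt with h0 | h0
  · rw [← h0] at h1 ⊢
    nlinarith
  · have h2 := level_eq_of_waterFill_pos hg h0
    rw [h2]
    apply le_of_eq
    ring

theorem gaussRate_waterFill_lt {N g l q : ℝ} (hN : 0 < N) (hg : 0 < g) (hl : 0 < l) (hq : 0 ≤ q)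
    (hne : q ≠ waterFill N g l) :
    gaussRate (q * g / N) - gaussRate (waterFill N g l * g / N)
      < (2 * Real.log 2)⁻¹ * ((q - waterFill N g l) / l) := by
  have hp := waterFill_nonneg N g l
  refine (gaussRate_sub_lt hN (by positivity) (by positivity)
    (fun h => hne (mul_right_cancel₀ hg.ne' h))).trans_le
    (mul_le_mul_of_nonneg_left ?_ rateScale_pos.le)
  have h1 := level_le_of_waterFill (N := N) (l := l) hg
  rw [div_le_div_iff₀ (by positivity) hl]
  rcases hp.eq_or_lt with h0 | h0
  · rw [← h0] at h1 ⊢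
    nlinarith
  · have h2 := level_eq_of_waterFill_pos hg h0
    rw [h2]
    apply le_of_eq
    ring

/-! ### Averaged water-filling: existence of levels, optimality, uniqueness -/

section Integrals

variable {Ω : Type*} [MeasurableSpace Ω] {μ : Measure Ω}

theorem integrable_gaussRate_div {N : ℝ} (hN : 0 < N) {n g Q : Ω → ℝ}
    (hn : Measurable n) (hg : Measurable g) (hQm : Measurable Q)
    (hnN : ∀ᵐ x ∂μ, N ≤ n x) (hgp : ∀ᵐ x ∂μ, 0 < g x)
    (hlog : Integrable (fun x => Real.log (1 + g x)) μ) (hQ0 : ∀ x, 0 ≤ Q x)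
    (hQ : Integrable Q μ) : Integrable (fun x => gaussRate (Q x * g x / n x)) μ := by
  refine Integrable.mono' (((hQ.const_mul N⁻¹).add hlog).const_mul (2 * Real.log 2)⁻¹)
    (Measurable.aestronglyMeasurable (by fun_prop)) ?_
  filter_upwards [hnN, hgp] with x h1 h2
  have h3 := hQ0 x
  have hnx : 0 < n x := hN.trans_le h1
  rw [Real.norm_of_nonneg (gaussRate_nonneg (by positivity))]
  have h4 : Q x * g x / n x ≤ N⁻¹ * Q x * g x := by
    rw [div_eq_mul_inv]
    have : (n x)⁻¹ ≤ N⁻¹ := inv_anti₀ hN h1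
    nlinarith [mul_le_mul_of_nonneg_left this (mul_nonneg h3 h2.le)]
  exact (gaussRate_le (by positivity) h4).trans (gaussRate_mul_le (by positivity) h2.le)

theorem integrable_waterFill [IsFiniteMeasure μ] {n g : Ω → ℝ} (hn : Measurable n)
    (hg : Measurable g) (hnp : ∀ᵐ x ∂μ, 0 < n x) {l : ℝ} :
    Integrable (fun x => waterFill (n x) (g x) l) μ := by
  refine Integrable.mono' (integrable_const (max l 0))
    (measurable_waterFill hn hg l).aestronglyMeasurable ?_
  filter_upwards [hnp] with x h1
  rw [Real.norm_of_nonneg (waterFill_nonneg _ _ _)]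
  unfold waterFill
  split_ifs with h
  · have := div_nonneg h1.le h.le
    exact max_le_max_right _ (by linarith)
  · exact le_max_right _ _

/-- A positive average power is spent by some water level. -/
theorem exists_waterLevel [IsProbabilityMeasure μ] {n g : Ω → ℝ} (hn : Measurable n)
    (hg : Measurable g) (hnp : ∀ᵐ x ∂μ, 0 < n x) (hgp : ∀ᵐ x ∂μ, 0 < g x) {B : ℝ} (hB : 0 < B) :
    ∃ l, ∫ x, waterFill (n x) (g x) l ∂μ = B := by
  set F : ℝ → ℝ := fun l => ∫ x, waterFill (n x) (g x) l ∂μ with hF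
  have hcont : Continuous F := by
    rw [continuous_iff_continuousAt]
    intro l₀
    refine tendsto_integral_filter_of_dominated_convergence (fun _ => |l₀| + 1) ?_ ?_
      (integrable_const _) ?_
    · exact Eventually.of_forall fun l => (measurable_waterFill hn hg l).aestronglyMeasurable
    · filter_upwards [Metric.ball_mem_nhds l₀ one_pos] with l hl
      filter_upwards [hnp] with x h1
      rw [Real.norm_of_nonneg (waterFill_nonneg _ _ _)]
      rw [Metric.mem_ball, Real.dist_eq] at hl
      have h2 : l ≤ |l₀| + 1 := by
        have := (le_abs_self (l - l₀)); have := le_abs_self l₀; linarith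
      unfold waterFill
      split_ifs with h
      · have := div_nonneg h1.le h.le
        exact max_le (by linarith) (by positivity)
      · positivity
    · refine Eventually.of_forall fun x => ?_
      have : Continuous fun l => waterFill (n x) (g x) l := by
        unfold waterFill
        split_ifs <;> fun_prop
      exact this.tendsto l₀
  have h0 : F 0 = 0 := by
    refine integral_eq_zero_of_ae ?_
    filter_upwards [hnp, hgp] with x h1 h2
    simp only [Pi.zero_apply]
    rw [waterFill, if_pos h2, max_eq_right]
    have := div_nonneg h1.le h2.le
    linarith
  -- Some sublevel set of `n / g` has positive measure; raising the level by `B / μ(S)` above `K`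
  -- then spends at least `B` on it, and the intermediate value theorem applies.
  obtain ⟨K, hK⟩ : ∃ K : ℕ, μ {x | n x / g x ≤ K} ≠ 0 := by
    by_contra! hcon
    have hU : μ (⋃ K : ℕ, {x | n x / g x ≤ K}) = 0 := measure_iUnion_null hcon
    have : (⋃ K : ℕ, {x | n x / g x ≤ K}) = univ := by
      ext x
      simp only [mem_iUnion, mem_ofPred_eq, mem_univ, iff_true]
      exact exists_nat_ge _
    rw [this, measure_univ] at hU
    exact one_ne_zero hU
  set S := {x | n x / g x ≤ (K : ℝ)} with hS
  have hSm : MeasurableSet S := measurableSet_le (by fun_prop) measurable_const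
  have hSp : 0 < μ.real S := ENNReal.toReal_pos hK (measure_ne_top _ _)
  set l₁ : ℝ := K + B / μ.real S with hl₁
  have h1 : B ≤ F l₁ := by
    have hi : Integrable (fun x => S.indicator (fun _ => B / μ.real S) x) μ :=
      (integrable_const _).indicator hSm
    have : ∫ x, S.indicator (fun _ => B / μ.real S) x ∂μ = B := by
      rw [integral_indicator_const _ hSm, smul_eq_mul]
      field_simp
    rw [← this]
    refine integral_mono_ae hi (integrable_waterFill hn hg hnp) ?_
    filter_upwards [hgp] with x h2
    by_cases hx : x ∈ S
    · rw [indicator_of_mem hx, waterFill, if_pos h2]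
      refine le_max_of_le_left ?_
      have : n x / g x ≤ K := hx
      linarith
    · rw [indicator_of_notMem hx]
      exact waterFill_nonneg _ _ _
  have hl₁0 : 0 ≤ l₁ := by positivity
  obtain ⟨l, -, hl⟩ := intermediate_value_Icc hl₁0 hcont.continuousOn
    (show B ∈ Icc (F 0) (F l₁) from ⟨by rw [h0]; exact hB.le, h1⟩)
  exact ⟨l, hl⟩

theorem level_pos_of_integral_pos {n g : Ω → ℝ} (hnp : ∀ᵐ x ∂μ, 0 < n x)
    {l : ℝ} (h : 0 < ∫ x, waterFill (n x) (g x) l ∂μ) : 0 < l := by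
  by_contra! hl
  refine h.ne' (integral_eq_zero_of_ae ?_)
  filter_upwards [hnp] with x h1
  simp only [Pi.zero_apply]
  unfold waterFill
  split_ifs with h2
  · have := div_nonneg h1.le h2.le
    exact max_eq_right (by linarith)
  · rfl

/-- Equality of integrals up to a nonpositive slack forces an a.e. identity. -/
theorem ae_eq_of_integral_le {F G H : Ω → ℝ} (hF : Integrable F μ) (hG : Integrable G μ)
    (hH : Integrable H μ) (hle : ∀ᵐ x ∂μ, F x - G x ≤ H x) (hH0 : ∫ x, H x ∂μ ≤ 0)
    (hge : ∫ x, G x ∂μ ≤ ∫ x, F x ∂μ) : ∀ᵐ x ∂μ, F x - G x = H x := by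
  have hi : Integrable (fun x => H x - (F x - G x)) μ := hH.sub (hF.sub hG)
  have h0 : 0 ≤ᵐ[μ] fun x => H x - (F x - G x) := by
    filter_upwards [hle] with x hx
    simpa using hx
  have h1 : ∫ x, (H x - (F x - G x)) ∂μ = 0 := by
    refine le_antisymm ?_ (integral_nonneg_of_ae h0)
    have h2 : ∫ x, (F x - G x) ∂μ = ∫ x, F x ∂μ - ∫ x, G x ∂μ := integral_sub hF hG
    have h3 : ∫ x, (H x - (F x - G x)) ∂μ = ∫ x, H x ∂μ - ∫ x, (F x - G x) ∂μ :=
      integral_sub hH (hF.sub hG)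
    linarith
  filter_upwards [(integral_eq_zero_iff_of_nonneg_ae h0 hi).1 h1] with x hx
  simp only [Pi.zero_apply] at hx
  linarith

theorem integral_le_of_slack {F G H : Ω → ℝ} (hF : Integrable F μ) (hG : Integrable G μ)
    (hH : Integrable H μ) (hle : ∀ᵐ x ∂μ, F x - G x ≤ H x) (hH0 : ∫ x, H x ∂μ ≤ 0) :
    ∫ x, F x ∂μ ≤ ∫ x, G x ∂μ := by
  have h := integral_mono_ae (hF.sub hG) hH hle
  simp only [Pi.sub_apply] at h
  rw [integral_sub hF hG] at h
  linarith

/-- Measurable nonnegative power policies of average power at most `B`. -/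
def policies (μ : Measure Ω) (B : ℝ) : Set (Ω → ℝ) :=
  {P | Measurable P ∧ (∀ x, 0 ≤ P x) ∧ Integrable P μ ∧ ∫ x, P x ∂μ ≤ B}

/-- The pointwise bound integrates to a nonpositive quantity because `Q` spends at most `B` and
water-filling exactly `B`. Equality of the rates forces equality pointwise a.e., where strictness
identifies the policies. -/
theorem waterFill_optimal [IsFiniteMeasure μ] {N : ℝ} (hN : 0 < N) {n g Q : Ω → ℝ}
    (hn : Measurable n) (hg : Measurable g)
    (hnN : ∀ᵐ x ∂μ, N ≤ n x) (hgp : ∀ᵐ x ∂μ, 0 < g x)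
    (hlog : Integrable (fun x => Real.log (1 + g x)) μ) {B l : ℝ} (hB : 0 < B)
    (hl : ∫ x, waterFill (n x) (g x) l ∂μ = B) (hQ : Q ∈ policies μ B) :
    ∫ x, gaussRate (Q x * g x / n x) ∂μ
        ≤ ∫ x, gaussRate (waterFill (n x) (g x) l * g x / n x) ∂μ ∧
      (∫ x, gaussRate (waterFill (n x) (g x) l * g x / n x) ∂μ
          ≤ ∫ x, gaussRate (Q x * g x / n x) ∂μ →
        ∀ᵐ x ∂μ, Q x = waterFill (n x) (g x) l) := by
  have hnp : ∀ᵐ x ∂μ, 0 < n x := hnN.mono fun x hx => hN.trans_le hx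
  have hl0 : 0 < l := level_pos_of_integral_pos hnp (hl ▸ hB)
  have hW : Integrable (fun x => waterFill (n x) (g x) l) μ := integrable_waterFill hn hg hnp
  have hF := integrable_gaussRate_div hN hn hg hQ.1 hnN hgp hlog hQ.2.1 hQ.2.2.1
  have hG := integrable_gaussRate_div hN hn hg (measurable_waterFill hn hg l) hnN hgp hlog
    (fun x => waterFill_nonneg _ _ _) hW
  have hH : Integrable
      (fun x => (2 * Real.log 2)⁻¹ * ((Q x - waterFill (n x) (g x) l) / l)) μ :=
    ((hQ.2.2.1.sub hW).div_const _).const_mul _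
  have hH0 : ∫ x, (2 * Real.log 2)⁻¹ * ((Q x - waterFill (n x) (g x) l) / l) ∂μ ≤ 0 := by
    rw [integral_const_mul, integral_div, integral_sub hQ.2.2.1 hW, hl]
    exact mul_nonpos_of_nonneg_of_nonpos rateScale_pos.le
      (div_nonpos_of_nonpos_of_nonneg (by linarith [hQ.2.2.2]) hl0.le)
  have hle : ∀ᵐ x ∂μ, gaussRate (Q x * g x / n x)
      - gaussRate (waterFill (n x) (g x) l * g x / n x)
      ≤ (2 * Real.log 2)⁻¹ * ((Q x - waterFill (n x) (g x) l) / l) := by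
    filter_upwards [hnp, hgp] with x h1 h2
    exact gaussRate_waterFill_le h1 h2 hl0 (hQ.2.1 x)
  refine ⟨integral_le_of_slack hF hG hH hle hH0, fun h => ?_⟩
  filter_upwards [ae_eq_of_integral_le hF hG hH hle hH0 h, hnp, hgp] with x h0 h1 h2
  by_contra hne
  exact (gaussRate_waterFill_lt h1 h2 hl0 (hQ.2.1 x) hne).ne h0

end Integrals

end FadingMAC

/-! ### The abstract two-user channel, its payoffs and best responses -/

/-- A two-user fading multiple access channel over an abstract probability space of fading states,
with gains that are a.e. positive and a.e. not proportional with any prescribed ratio. -/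
structure TwoUserChannel (Ω : Type*) [MeasurableSpace Ω] where
  μ : Measure Ω
  prob : IsProbabilityMeasure μ
  /-- noise variance -/
  N : ℝ
  N_pos : 0 < N
  /-- gains -/
  g₁ : Ω → ℝ
  g₂ : Ω → ℝ
  /-- power budgets -/
  B₁ : ℝ
  B₂ : ℝ
  B₁_pos : 0 < B₁
  B₂_pos : 0 < B₂
  measurable_g₁ : Measurable g₁
  measurable_g₂ : Measurable g₂
  g₁_pos : ∀ᵐ x ∂μ, 0 < g₁ x
  g₂_pos : ∀ᵐ x ∂μ, 0 < g₂ x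
  log_g₁ : Integrable (fun x => Real.log (1 + g₁ x)) μ
  log_g₂ : Integrable (fun x => Real.log (1 + g₂ x)) μ
  no_tie : ∀ s t : ℝ, 0 < s → 0 < t → ∀ᵐ x ∂μ, s * g₁ x ≠ t * g₂ x

namespace TwoUserChannel

variable {Ω : Type*} [MeasurableSpace Ω] (c : TwoUserChannel Ω)

instance : IsProbabilityMeasure c.μ := c.prob

attribute [fun_prop] measurable_g₁ measurable_g₂

/-- The channel with the users exchanged. -/
def swap : TwoUserChannel Ω where
  μ := c.μ
  prob := c.prob
  N := c.N
  N_pos := c.N_pos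
  g₁ := c.g₂
  g₂ := c.g₁
  B₁ := c.B₂
  B₂ := c.B₁
  B₁_pos := c.B₂_pos
  B₂_pos := c.B₁_pos
  measurable_g₁ := c.measurable_g₂
  measurable_g₂ := c.measurable_g₁
  g₁_pos := c.g₂_pos
  g₂_pos := c.g₁_pos
  log_g₁ := c.log_g₂
  log_g₂ := c.log_g₁
  no_tie := fun s t hs ht => (c.no_tie t s ht hs).mono fun _ h => h.symm

/-- Noise plus interference seen by user 1 when it is decoded first on `D`. -/
noncomputable def noise (D : Set Ω) (P₂ : Ω → ℝ) (x : Ω) : ℝ := c.N + D.indicator (fun y => P₂ y * c.g₂ y) x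

/-- Rate of user 1 when it is decoded first exactly on `D`. -/
noncomputable def payoff (D : Set Ω) (P₁ P₂ : Ω → ℝ) : ℝ :=
  ∫ x, gaussRate (P₁ x * c.g₁ x / c.noise D P₂ x) ∂c.μ

/-- Rate of user 1 without interference. -/
noncomputable def soloRate (P₁ : Ω → ℝ) : ℝ := ∫ x, gaussRate (P₁ x * c.g₁ x / c.N) ∂c.μ

noncomputable def sumRate (P₁ P₂ : Ω → ℝ) : ℝ := ∫ x, gaussRate ((P₁ x * c.g₁ x + P₂ x * c.g₂ x) / c.N) ∂c.μ

def region : Set (ℝ × ℝ) :=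
  {R | ∃ P₁ ∈ policies c.μ c.B₁, ∃ P₂ ∈ policies c.μ c.B₂, 0 ≤ R.1 ∧ 0 ≤ R.2 ∧
    R.1 ≤ c.soloRate P₁ ∧ R.2 ≤ c.swap.soloRate P₂ ∧ R.1 + R.2 ≤ c.sumRate P₁ P₂}

def IsNash (D : Set Ω) (P₁ P₂ : Ω → ℝ) : Prop :=
  P₁ ∈ policies c.μ c.B₁ ∧ P₂ ∈ policies c.μ c.B₂ ∧
    (∀ Q₁ ∈ policies c.μ c.B₁, c.payoff D Q₁ P₂ ≤ c.payoff D P₁ P₂) ∧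
    (∀ Q₂ ∈ policies c.μ c.B₂, c.swap.payoff Dᶜ Q₂ P₁ ≤ c.swap.payoff Dᶜ P₂ P₁)

theorem isNash_swap {D : Set Ω} {P₁ P₂ : Ω → ℝ} (h : c.IsNash D P₁ P₂) :
    c.swap.IsNash Dᶜ P₂ P₁ := by
  refine ⟨h.2.1, h.1, h.2.2.2, ?_⟩
  rw [compl_compl]
  exact h.2.2.1

theorem sumRate_swap (P₁ P₂ : Ω → ℝ) : c.swap.sumRate P₂ P₁ = c.sumRate P₁ P₂ := by
  unfold sumRate
  congr 1
  ext x
  rw [add_comm]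
  rfl

theorem swap_mem_region {R : ℝ × ℝ} (h : R ∈ c.region) : R.swap ∈ c.swap.region := by
  obtain ⟨P₁, h1, P₂, h2, h3, h4, h5, h6, h7⟩ := h
  refine ⟨P₂, h2, P₁, h1, h4, h3, h6, h5, ?_⟩
  rw [sumRate_swap, Prod.fst_swap, Prod.snd_swap, add_comm]
  exact h7

theorem mem_region_swap {R : ℝ × ℝ} (h : R ∈ c.swap.region) : R.swap ∈ c.region :=
  c.swap.swap_mem_region h

theorem measurable_noise {D : Set Ω} (hD : MeasurableSet D) {P₂ : Ω → ℝ} (h : Measurable P₂) :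
    Measurable (c.noise D P₂) := by
  unfold noise
  have : Measurable (D.indicator (fun y => P₂ y * c.g₂ y)) :=
    Measurable.indicator (by fun_prop) hD
  fun_prop

theorem le_noise (D : Set Ω) {P₂ : Ω → ℝ} (h : ∀ x, 0 ≤ P₂ x) :
    ∀ᵐ x ∂c.μ, c.N ≤ c.noise D P₂ x := by
  filter_upwards [c.g₂_pos] with x hx
  unfold noise
  have : 0 ≤ D.indicator (fun y => P₂ y * c.g₂ y) x := by
    by_cases hD : x ∈ D
    · rw [indicator_of_mem hD]
      exact mul_nonneg (h x) hx.le
    · rw [indicator_of_notMem hD]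
  linarith

theorem noise_of_mem {D : Set Ω} {x : Ω} (h : x ∈ D) (P₂ : Ω → ℝ) :
    c.noise D P₂ x = c.N + P₂ x * c.g₂ x := by
  rw [noise, indicator_of_mem h]

theorem noise_of_notMem {D : Set Ω} {x : Ω} (h : x ∉ D) (P₂ : Ω → ℝ) :
    c.noise D P₂ x = c.N := by
  rw [noise, indicator_of_notMem h, add_zero]

theorem integrable_payoff {D : Set Ω} (hD : MeasurableSet D) {P₁ P₂ : Ω → ℝ} {A B : ℝ}
    (h1 : P₁ ∈ policies c.μ A) (h2 : P₂ ∈ policies c.μ B) :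
    Integrable (fun x => gaussRate (P₁ x * c.g₁ x / c.noise D P₂ x)) c.μ :=
  integrable_gaussRate_div c.N_pos (c.measurable_noise hD h2.1) c.measurable_g₁ h1.1
    (c.le_noise D h2.2.1) c.g₁_pos c.log_g₁ h1.2.1 h1.2.2.1

theorem integrable_soloRate {P₁ : Ω → ℝ} {A : ℝ} (h1 : P₁ ∈ policies c.μ A) :
    Integrable (fun x => gaussRate (P₁ x * c.g₁ x / c.N)) c.μ :=
  integrable_gaussRate_div c.N_pos measurable_const c.measurable_g₁ h1.1
    (Eventually.of_forall fun _ => le_rfl) c.g₁_pos c.log_g₁ h1.2.1 h1.2.2.1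

theorem integrable_sumRate {P₁ P₂ : Ω → ℝ} {A B : ℝ}
    (h1 : P₁ ∈ policies c.μ A) (h2 : P₂ ∈ policies c.μ B) :
    Integrable (fun x => gaussRate ((P₁ x * c.g₁ x + P₂ x * c.g₂ x) / c.N)) c.μ := by
  have hm1 := h1.1
  have hm2 := h2.1
  refine Integrable.mono' ((c.integrable_soloRate h1).add (c.swap.integrable_soloRate h2))
    (Measurable.aestronglyMeasurable (by fun_prop)) ?_
  filter_upwards [c.g₁_pos, c.g₂_pos] with x hx1 hx2
  have hN := c.N_pos
  have h3 : 0 ≤ P₁ x * c.g₁ x / c.N := div_nonneg (mul_nonneg (h1.2.1 x) hx1.le) hN.le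
  have h4 : 0 ≤ P₂ x * c.g₂ x / c.N := div_nonneg (mul_nonneg (h2.2.1 x) hx2.le) hN.le
  rw [add_div, Real.norm_of_nonneg (gaussRate_nonneg (by positivity))]
  exact gaussRate_add_le h3 h4

/-- The two payoffs add up to the sum rate. -/
theorem payoff_add_payoff {D : Set Ω} (hD : MeasurableSet D) {P₁ P₂ : Ω → ℝ} {A B : ℝ}
    (h1 : P₁ ∈ policies c.μ A) (h2 : P₂ ∈ policies c.μ B) :
    c.payoff D P₁ P₂ + c.swap.payoff Dᶜ P₂ P₁ = c.sumRate P₁ P₂ := by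
  unfold payoff sumRate
  refine (integral_add (c.integrable_payoff hD h1 h2)
    (c.swap.integrable_payoff hD.compl h2 h1)).symm.trans ?_
  refine integral_congr_ae ?_
  filter_upwards [c.g₁_pos, c.g₂_pos] with x hx1 hx2
  have h3 := mul_nonneg (h1.2.1 x) hx1.le
  have h4 := mul_nonneg (h2.2.1 x) hx2.le
  by_cases hx : x ∈ D
  · rw [c.noise_of_mem hx, c.swap.noise_of_notMem (by simpa using hx)]
    exact gaussRate_successive c.N_pos h3 h4
  · rw [c.noise_of_notMem hx, c.swap.noise_of_mem (by simpa using hx)]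
    rw [add_comm, add_comm (P₁ x * c.g₁ x)]
    exact gaussRate_successive c.N_pos h4 h3

theorem payoff_nonneg (D : Set Ω) {P₁ P₂ : Ω → ℝ} {A B : ℝ}
    (h1 : P₁ ∈ policies c.μ A) (h2 : P₂ ∈ policies c.μ B) : 0 ≤ c.payoff D P₁ P₂ := by
  refine integral_nonneg_of_ae ?_
  filter_upwards [c.g₁_pos, c.le_noise D h2.2.1] with x hx1 hx2
  exact gaussRate_nonneg (div_nonneg (mul_nonneg (h1.2.1 x) hx1.le) (c.N_pos.le.trans hx2))

/-- Interference strictly lowers the rate in every state of `D` where both users transmit, so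
equality of the averages leaves only a null set of such states. -/
theorem payoff_le_soloRate {D : Set Ω} (hD : MeasurableSet D) {P₁ P₂ : Ω → ℝ} {A B : ℝ}
    (h1 : P₁ ∈ policies c.μ A) (h2 : P₂ ∈ policies c.μ B) :
    c.payoff D P₁ P₂ ≤ c.soloRate P₁ ∧
      (c.payoff D P₁ P₂ = c.soloRate P₁ → ∀ᵐ x ∂c.μ, x ∈ D → P₁ x = 0 ∨ P₂ x = 0) := by
  have hle : ∀ᵐ x ∂c.μ, gaussRate (P₁ x * c.g₁ x / c.noise D P₂ x)
      ≤ gaussRate (P₁ x * c.g₁ x / c.N) := by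
    filter_upwards [c.g₁_pos, c.le_noise D h2.2.1] with x hx1 hx2
    have h3 := mul_nonneg (h1.2.1 x) hx1.le
    exact gaussRate_le (div_nonneg h3 (c.N_pos.le.trans hx2))
      (div_le_div_of_nonneg_left h3 c.N_pos hx2)
  have hi1 := c.integrable_payoff hD h1 h2
  have hi2 := c.integrable_soloRate h1
  refine ⟨integral_mono_ae hi1 hi2 hle, fun heq => ?_⟩
  have h := (integral_eq_iff_of_ae_le hi1 hi2 hle).1 heq
  filter_upwards [h, c.g₁_pos, c.g₂_pos] with x hx hx1 hx2 hxD
  by_contra! hne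
  have hp1 : 0 < P₁ x := lt_of_le_of_ne (h1.2.1 x) hne.1.symm
  have hp2 : 0 < P₂ x := lt_of_le_of_ne (h2.2.1 x) hne.2.symm
  have hN := c.N_pos
  rw [c.noise_of_mem hxD] at hx
  refine (gaussRate_lt (by positivity) ?_).ne hx
  exact div_lt_div_of_pos_left (by positivity) hN (by linarith [mul_pos hp2 hx2])

theorem payoff_mem_region {D : Set Ω} (hD : MeasurableSet D) {P₁ P₂ : Ω → ℝ}
    (h1 : P₁ ∈ policies c.μ c.B₁) (h2 : P₂ ∈ policies c.μ c.B₂) :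
    (c.payoff D P₁ P₂, c.swap.payoff Dᶜ P₂ P₁) ∈ c.region :=
  ⟨P₁, h1, P₂, h2, c.payoff_nonneg D h1 h2, c.swap.payoff_nonneg Dᶜ h2 h1,
    (c.payoff_le_soloRate hD h1 h2).1, (c.swap.payoff_le_soloRate hD.compl h2 h1).1,
    (c.payoff_add_payoff hD h1 h2).le⟩

theorem waterFill_mem_policies {n : Ω → ℝ} (hn : Measurable n) (hnp : ∀ᵐ x ∂c.μ, 0 < n x) {B l : ℝ}
    (hl : ∫ x, waterFill (n x) (c.g₁ x) l ∂c.μ = B) :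
    (fun x => waterFill (n x) (c.g₁ x) l) ∈ policies c.μ B :=
  ⟨measurable_waterFill hn c.measurable_g₁ l, fun _ => waterFill_nonneg _ _ _,
    integrable_waterFill hn c.measurable_g₁ hnp, hl.le⟩

/-- The best response of user 1 is unique and is water-filling over noise plus interference. -/
theorem bestResponse_iff {D : Set Ω} (hD : MeasurableSet D) {P₁ P₂ : Ω → ℝ} {B : ℝ}
    (h1 : P₁ ∈ policies c.μ c.B₁) (h2 : P₂ ∈ policies c.μ B) :
    (∀ Q ∈ policies c.μ c.B₁, c.payoff D Q P₂ ≤ c.payoff D P₁ P₂) ↔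
      ∃ l, 0 < l ∧ ∫ x, waterFill (c.noise D P₂ x) (c.g₁ x) l ∂c.μ = c.B₁ ∧
        ∀ᵐ x ∂c.μ, P₁ x = waterFill (c.noise D P₂ x) (c.g₁ x) l := by
  have hn := c.measurable_noise hD h2.1
  have hnN := c.le_noise D h2.2.1
  have hnp : ∀ᵐ x ∂c.μ, 0 < c.noise D P₂ x := hnN.mono fun x hx => c.N_pos.trans_le hx
  constructor
  · intro h
    obtain ⟨l, hl⟩ := exists_waterLevel hn c.measurable_g₁ hnp c.g₁_pos c.B₁_pos
    refine ⟨l, level_pos_of_integral_pos hnp (hl ▸ c.B₁_pos), hl, ?_⟩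
    exact (waterFill_optimal c.N_pos hn c.measurable_g₁ hnN c.g₁_pos c.log_g₁ c.B₁_pos hl h1).2
      (h _ (c.waterFill_mem_policies hn hnp hl))
  · rintro ⟨l, -, hl, hP⟩ Q hQ
    refine (waterFill_optimal c.N_pos hn c.measurable_g₁ hnN c.g₁_pos c.log_g₁ c.B₁_pos hl
      hQ).1.trans_eq (integral_congr_ae ?_)
    filter_upwards [hP] with x hx
    simp only [hx]

/-- A best response spends the whole positive budget, so it transmits on a set of positive measure.
Positivity is what the supporting-line argument requires of a boundary payoff. -/
theorem payoff_pos_of_bestResponse {D : Set Ω} (hD : MeasurableSet D) {P₁ P₂ : Ω → ℝ} {B : ℝ}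
    (h1 : P₁ ∈ policies c.μ c.B₁) (h2 : P₂ ∈ policies c.μ B)
    (h : ∀ Q ∈ policies c.μ c.B₁, c.payoff D Q P₂ ≤ c.payoff D P₁ P₂) :
    0 < c.payoff D P₁ P₂ := by
  obtain ⟨l, hl0, hl, hP⟩ := (c.bestResponse_iff hD h1 h2).1 h
  refine lt_of_le_of_ne (c.payoff_nonneg D h1 h2) fun h0 => ?_
  have hnn : 0 ≤ᵐ[c.μ] fun x => gaussRate (P₁ x * c.g₁ x / c.noise D P₂ x) := by
    filter_upwards [c.g₁_pos, c.le_noise D h2.2.1] with x hx1 hx2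
    exact gaussRate_nonneg (div_nonneg (mul_nonneg (h1.2.1 x) hx1.le) (c.N_pos.le.trans hx2))
  have h3 := (integral_eq_zero_iff_of_nonneg_ae hnn (c.integrable_payoff hD h1 h2)).1 h0.symm
  have h4 : ∫ x, waterFill (c.noise D P₂ x) (c.g₁ x) l ∂c.μ = 0 := by
    refine integral_eq_zero_of_ae ?_
    filter_upwards [h3, hP, c.g₁_pos, c.le_noise D h2.2.1] with x hx hPx hx1 hx2
    simp only [Pi.zero_apply] at hx ⊢
    rw [← hPx]
    by_contra hne
    have hp1 : 0 < P₁ x := lt_of_le_of_ne (h1.2.1 x) (Ne.symm hne)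
    have hn := c.N_pos.trans_le hx2
    have := gaussRate_lt le_rfl (show 0 < P₁ x * c.g₁ x / c.noise D P₂ x by positivity)
    rw [gaussRate_zero] at this
    exact this.ne' hx
  exact c.B₁_pos.ne' (hl.symm.trans h4)

/-! ### Corner points -/

/-- User 1 water-fills over the noise, user 2 over the noise and user 1, at full power. -/
def IsCorner (R : ℝ × ℝ) : Prop :=
  ∃ (l₁ l₂ : ℝ) (P₁ P₂ : Ω → ℝ),
    (∀ x, P₁ x = waterFill c.N (c.g₁ x) l₁) ∧
    (∀ x, P₂ x = waterFill (c.N + P₁ x * c.g₁ x) (c.g₂ x) l₂) ∧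
    ∫ x, P₁ x ∂c.μ = c.B₁ ∧ ∫ x, P₂ x ∂c.μ = c.B₂ ∧
    R = (c.soloRate P₁, ∫ x, gaussRate (P₂ x * c.g₂ x / (c.N + P₁ x * c.g₁ x)) ∂c.μ)

theorem noise_empty (P : Ω → ℝ) (x : Ω) : c.noise ∅ P x = c.N := c.noise_of_notMem (by simp) P

theorem noise_swap_univ (P : Ω → ℝ) (x : Ω) :
    c.swap.noise (∅ : Set Ω)ᶜ P x = c.N + P x * c.g₁ x := c.swap.noise_of_mem (by simp) P

theorem payoff_empty (P₁ P₂ : Ω → ℝ) : c.payoff ∅ P₁ P₂ = c.soloRate P₁ := by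
  simp only [payoff, noise_empty, soloRate]

/-- The corner points are the payoffs of the equilibria of the game with `D = ∅`. -/
theorem isCorner_iff_nash (R : ℝ × ℝ) : c.IsCorner R ↔ ∃ P₁ P₂, c.IsNash ∅ P₁ P₂ ∧
    R = (c.payoff ∅ P₁ P₂, c.swap.payoff ∅ᶜ P₂ P₁) := by
  have hN := c.N_pos
  constructor
  · rintro ⟨l₁, l₂, P₁, P₂, h1, h2, h3, h4, rfl⟩
    have hP₁ : P₁ ∈ policies c.μ c.B₁ := by
      have : P₁ = fun x => waterFill c.N (c.g₁ x) l₁ := funext h1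
      rw [this] at h3 ⊢
      exact c.waterFill_mem_policies measurable_const (Eventually.of_forall fun _ => c.N_pos) h3
    have hm := c.swap.measurable_noise (MeasurableSet.empty.compl) hP₁.1
    have hle := c.swap.le_noise (∅ : Set Ω)ᶜ hP₁.2.1
    have hP₂e : P₂ = fun x => waterFill (c.swap.noise (∅ : Set Ω)ᶜ P₁ x) (c.swap.g₁ x) l₂ := by
      ext x
      rw [h2, noise_swap_univ]
      rfl
    have hP₂ : P₂ ∈ policies c.μ c.B₂ := by
      rw [hP₂e] at h4 ⊢
      exact c.swap.waterFill_mem_policies hm (hle.mono fun x hx => c.N_pos.trans_le hx) h4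
    refine ⟨P₁, P₂, ⟨hP₁, hP₂, ?_, ?_⟩, ?_⟩
    · rw [c.bestResponse_iff MeasurableSet.empty hP₁ hP₂]
      simp only [noise_empty]
      have h5 : ∫ x, waterFill c.N (c.g₁ x) l₁ ∂c.μ = c.B₁ := by simpa only [h1] using h3
      exact ⟨l₁, level_pos_of_integral_pos (n := fun _ => c.N)
        (Eventually.of_forall fun _ => hN) (h5 ▸ c.B₁_pos), h5, Eventually.of_forall h1⟩
    · refine (c.swap.bestResponse_iff MeasurableSet.empty.compl hP₂ hP₁).2 ⟨l₂, ?_, ?_, ?_⟩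
      · refine level_pos_of_integral_pos (n := c.swap.noise (∅ : Set Ω)ᶜ P₁)
          (g := c.swap.g₁) (μ := c.μ) (hle.mono fun x hx => c.N_pos.trans_le hx) ?_
        have := c.B₂_pos
        rwa [← h4, hP₂e] at this
      · rw [hP₂e] at h4
        exact h4
      · exact Eventually.of_forall fun x => congrFun hP₂e x
    · rw [payoff_empty, payoff]
      simp only [noise_swap_univ]
      rfl
  · rintro ⟨P₁, P₂, hN', rfl⟩
    obtain ⟨hP₁, hP₂, hb1, hb2⟩ := hN'
    obtain ⟨l₁, -, hl₁, he₁⟩ := (c.bestResponse_iff MeasurableSet.empty hP₁ hP₂).1 hb1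
    obtain ⟨l₂, -, hl₂, he₂⟩ :=
      (c.swap.bestResponse_iff MeasurableSet.empty.compl hP₂ hP₁).1 hb2
    simp only [noise_empty] at hl₁ he₁
    simp only [noise_swap_univ] at hl₂ he₂
    -- Equilibrium policies are water-filling only a.e., while a corner point asks for it in every
    -- state; the exact formulas replace them without changing any integral.
    refine ⟨l₁, l₂, fun x => waterFill c.N (c.g₁ x) l₁,
      fun x => waterFill (c.N + waterFill c.N (c.g₁ x) l₁ * c.g₁ x) (c.g₂ x) l₂,
      fun _ => rfl, fun _ => rfl, hl₁, ?_, ?_⟩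
    · refine Eq.trans (integral_congr_ae ?_) hl₂
      filter_upwards [he₁] with x hx
      simp only [hx]
      rfl
    · rw [payoff_empty, payoff]
      simp only [noise_swap_univ]
      ext
      · refine integral_congr_ae ?_
        filter_upwards [he₁] with x hx
        simp only [hx]
      · refine integral_congr_ae ?_
        filter_upwards [he₁, he₂] with x hx1 hx2
        simp only [hx1, hx2]
        rfl

/-- All equilibria of the game with `D = ∅` have the same payoffs. -/
theorem nash_empty_unique {P₁ P₂ Q₁ Q₂ : Ω → ℝ} (hP : c.IsNash ∅ P₁ P₂) (hQ : c.IsNash ∅ Q₁ Q₂) :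
    c.payoff ∅ P₁ P₂ = c.payoff ∅ Q₁ Q₂ ∧
      c.swap.payoff ∅ᶜ P₂ P₁ = c.swap.payoff ∅ᶜ Q₂ Q₁ := by
  have h1 : c.payoff ∅ P₁ P₂ = c.payoff ∅ Q₁ Q₂ := by
    have h2 := hP.2.2.1 Q₁ hQ.1
    have h3 := hQ.2.2.1 P₁ hP.1
    simp only [payoff_empty] at *
    linarith
  obtain ⟨l₁, -, hl₁, he₁⟩ := (c.bestResponse_iff MeasurableSet.empty hP.1 hP.2.1).1 hP.2.2.1
  simp only [noise_empty] at hl₁ he₁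
  -- User 1 has the same policy a.e. in both equilibria, so user 2 faces the same interference and
  -- the same optimal value.
  have hQe : ∀ᵐ x ∂c.μ, Q₁ x = waterFill c.N (c.g₁ x) l₁ := by
    refine (waterFill_optimal (n := fun _ => c.N) c.N_pos measurable_const c.measurable_g₁
      (Eventually.of_forall fun _ => le_rfl) c.g₁_pos c.log_g₁ c.B₁_pos hl₁ hQ.1).2 ?_
    have h4 : ∫ x, gaussRate (waterFill c.N (c.g₁ x) l₁ * c.g₁ x / c.N) ∂c.μ = c.soloRate P₁ := by
      refine integral_congr_ae ?_
      filter_upwards [he₁] with x hx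
      simp only [hx]
    rw [h4]
    simp only [payoff_empty] at h1
    exact h1.le
  have hcongr : ∀ R : Ω → ℝ, c.swap.payoff ∅ᶜ R P₁ = c.swap.payoff ∅ᶜ R Q₁ := by
    intro R
    unfold payoff
    simp only [noise_swap_univ]
    refine integral_congr_ae ?_
    filter_upwards [he₁, hQe] with x hx1 hx2
    simp only [hx1, hx2]
  refine ⟨h1, ?_⟩
  have h2 := hP.2.2.2 Q₂ hQ.2.1
  have h3 := hQ.2.2.2 P₂ hP.2.1
  rw [hcongr] at h2 ⊢
  rw [hcongr] at h2
  linarith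

theorem exists_isCorner : ∃ R, c.IsCorner R := by
  obtain ⟨l₁, hl₁⟩ := exists_waterLevel (n := fun _ => c.N) measurable_const c.measurable_g₁
    (Eventually.of_forall fun _ => c.N_pos) c.g₁_pos c.B₁_pos
  have hP₁ := c.waterFill_mem_policies measurable_const (Eventually.of_forall fun _ => c.N_pos) hl₁
  have hm := c.swap.measurable_noise (MeasurableSet.empty.compl) hP₁.1
  have hle := c.swap.le_noise (∅ : Set Ω)ᶜ hP₁.2.1
  obtain ⟨l₂, hl₂⟩ := exists_waterLevel hm c.measurable_g₂
    (hle.mono fun x hx => c.N_pos.trans_le hx) c.g₂_pos c.B₂_pos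
  simp only [noise_swap_univ] at hl₂
  exact ⟨_, l₁, l₂, _, _, fun _ => rfl, fun _ => rfl, hl₁, hl₂, rfl⟩

theorem exists_unique_corner : ∃ C, ∀ R, c.IsCorner R ↔ R = C := by
  obtain ⟨C, hC⟩ := c.exists_isCorner
  refine ⟨C, fun R => ⟨fun hR => ?_, fun h => h ▸ hC⟩⟩
  obtain ⟨P₁, P₂, hP, rfl⟩ := (c.isCorner_iff_nash _).1 hC
  obtain ⟨Q₁, Q₂, hQ, rfl⟩ := (c.isCorner_iff_nash _).1 hR
  have h := c.nash_empty_unique hQ hP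
  rw [h.1, h.2]

/-- No point of the region has a larger first rate than the corner point. -/
theorem fst_le_corner {C R : ℝ × ℝ} (hC : c.IsCorner C) (hR : R ∈ c.region) : R.1 ≤ C.1 := by
  obtain ⟨P₁, P₂, hP, rfl⟩ := (c.isCorner_iff_nash _).1 hC
  obtain ⟨Q₁, hQ₁, Q₂, -, -, -, h, -⟩ := hR
  have := hP.2.2.1 Q₁ hQ₁
  simp only [payoff_empty] at *
  linarith

theorem corner_mem_region {C : ℝ × ℝ} (hC : c.IsCorner C) : C ∈ c.region := by
  obtain ⟨P₁, P₂, hP, rfl⟩ := (c.isCorner_iff_nash _).1 hC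
  exact c.payoff_mem_region MeasurableSet.empty hP.1 hP.2.1

end TwoUserChannel

namespace TwoUserChannel

variable {Ω : Type*} [MeasurableSpace Ω] (c : TwoUserChannel Ω)

/-! ### Maximal sum rate -/

/-- Complementary slackness conditions for the sum rate at water levels `l₁, l₂`. -/
def SumKKT (l₁ l₂ : ℝ) (P₁ P₂ : Ω → ℝ) : Prop :=
  ∀ᵐ x ∂c.μ, l₁ * c.g₁ x ≤ c.N + (P₁ x * c.g₁ x + P₂ x * c.g₂ x) ∧
    l₂ * c.g₂ x ≤ c.N + (P₁ x * c.g₁ x + P₂ x * c.g₂ x) ∧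
    (0 < P₁ x → c.N + (P₁ x * c.g₁ x + P₂ x * c.g₂ x) = l₁ * c.g₁ x) ∧
    (0 < P₂ x → c.N + (P₁ x * c.g₁ x + P₂ x * c.g₂ x) = l₂ * c.g₂ x)

/-- For `p > 0` both sides agree; for `p = 0` the increment is nonnegative and `g / T ≤ 1 / l`. -/
theorem slack_le {l g T p q : ℝ} (hl : 0 < l) (hT : 0 < T) (hp : 0 ≤ p) (hq : 0 ≤ q)
    (h1 : l * g ≤ T) (h2 : 0 < p → T = l * g) : (q - p) * g / T ≤ (q - p) / l := by
  rw [div_le_div_iff₀ hT hl]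
  rcases hp.eq_or_lt with rfl | hp
  · nlinarith
  · rw [h2 hp]
    apply le_of_eq
    ring

/-- Lagrangian bound at a point satisfying the slackness conditions. -/
theorem sum_slack_le {N a b l₁ l₂ p₁ p₂ q₁ q₂ : ℝ} (hN : 0 < N) (ha : 0 < a) (hb : 0 < b)
    (hl₁ : 0 < l₁) (hl₂ : 0 < l₂) (hp₁ : 0 ≤ p₁) (hp₂ : 0 ≤ p₂) (hq₁ : 0 ≤ q₁) (hq₂ : 0 ≤ q₂)
    (h1 : l₁ * a ≤ N + (p₁ * a + p₂ * b)) (h2 : l₂ * b ≤ N + (p₁ * a + p₂ * b))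
    (h3 : 0 < p₁ → N + (p₁ * a + p₂ * b) = l₁ * a)
    (h4 : 0 < p₂ → N + (p₁ * a + p₂ * b) = l₂ * b) :
    ((q₁ * a + q₂ * b) - (p₁ * a + p₂ * b)) / (N + (p₁ * a + p₂ * b))
      ≤ (q₁ - p₁) / l₁ + (q₂ - p₂) / l₂ := by
  have hT : 0 < N + (p₁ * a + p₂ * b) := by positivity
  have e1 := slack_le hl₁ hT hp₁ hq₁ h1 h3
  have e2 := slack_le hl₂ hT hp₂ hq₂ h2 h4
  have : ((q₁ * a + q₂ * b) - (p₁ * a + p₂ * b)) / (N + (p₁ * a + p₂ * b))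
      = (q₁ - p₁) * a / (N + (p₁ * a + p₂ * b)) + (q₂ - p₂) * b / (N + (p₁ * a + p₂ * b)) := by
    rw [← add_div]
    congr 1
    ring
  linarith

/-- By concavity the slackness conditions suffice for optimality. At equality the increments of the
two powers solve two linear equations, equal received power and zero priced cost, with determinant
`l₁ g₁ - l₂ g₂` up to sign, which is nonzero a.e. -/
theorem sumRate_le_of_sumKKT {l₁ l₂ : ℝ} (hl₁ : 0 < l₁) (hl₂ : 0 < l₂) {P₁ P₂ Q₁ Q₂ : Ω → ℝ}
    (hP₁ : P₁ ∈ policies c.μ c.B₁) (hP₂ : P₂ ∈ policies c.μ c.B₂)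
    (hQ₁ : Q₁ ∈ policies c.μ c.B₁) (hQ₂ : Q₂ ∈ policies c.μ c.B₂)
    (hB₁ : ∫ x, P₁ x ∂c.μ = c.B₁) (hB₂ : ∫ x, P₂ x ∂c.μ = c.B₂)
    (hK : c.SumKKT l₁ l₂ P₁ P₂) :
    c.sumRate Q₁ Q₂ ≤ c.sumRate P₁ P₂ ∧
      (c.sumRate P₁ P₂ ≤ c.sumRate Q₁ Q₂ → (∀ᵐ x ∂c.μ, P₁ x = 0 ∨ P₂ x = 0) →
        ∀ᵐ x ∂c.μ, Q₁ x = P₁ x ∧ Q₂ x = P₂ x) := by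
  have hF := c.integrable_sumRate hQ₁ hQ₂
  have hG := c.integrable_sumRate hP₁ hP₂
  have hd₁ : Integrable (fun x => (Q₁ x - P₁ x) / l₁) c.μ := (hQ₁.2.2.1.sub hP₁.2.2.1).div_const _
  have hd₂ : Integrable (fun x => (Q₂ x - P₂ x) / l₂) c.μ := (hQ₂.2.2.1.sub hP₂.2.2.1).div_const _
  have hH : Integrable (fun x => (2 * Real.log 2)⁻¹ *
      ((Q₁ x - P₁ x) / l₁ + (Q₂ x - P₂ x) / l₂)) c.μ := (hd₁.add hd₂).const_mul _
  have hH0 : ∫ x, (2 * Real.log 2)⁻¹ * ((Q₁ x - P₁ x) / l₁ + (Q₂ x - P₂ x) / l₂) ∂c.μ ≤ 0 := by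
    rw [integral_const_mul, integral_add hd₁ hd₂, integral_div, integral_div,
      integral_sub hQ₁.2.2.1 hP₁.2.2.1, integral_sub hQ₂.2.2.1 hP₂.2.2.1, hB₁, hB₂]
    refine mul_nonpos_of_nonneg_of_nonpos rateScale_pos.le (add_nonpos ?_ ?_)
    · exact div_nonpos_of_nonpos_of_nonneg (by linarith [hQ₁.2.2.2]) hl₁.le
    · exact div_nonpos_of_nonpos_of_nonneg (by linarith [hQ₂.2.2.2]) hl₂.le
  have hle : ∀ᵐ x ∂c.μ, gaussRate ((Q₁ x * c.g₁ x + Q₂ x * c.g₂ x) / c.N)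
      - gaussRate ((P₁ x * c.g₁ x + P₂ x * c.g₂ x) / c.N)
      ≤ (2 * Real.log 2)⁻¹ * ((Q₁ x - P₁ x) / l₁ + (Q₂ x - P₂ x) / l₂) := by
    filter_upwards [hK, c.g₁_pos, c.g₂_pos] with x hx ha hb
    have hq₁ := hQ₁.2.1 x
    have hq₂ := hQ₂.2.1 x
    have hp₁ := hP₁.2.1 x
    have hp₂ := hP₂.2.1 x
    exact (gaussRate_sub_le c.N_pos (by positivity) (by positivity)).trans
      (mul_le_mul_of_nonneg_left (sum_slack_le c.N_pos ha hb hl₁ hl₂ hp₁ hp₂ hq₁ hq₂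
        hx.1 hx.2.1 hx.2.2.1 hx.2.2.2) rateScale_pos.le)
  refine ⟨integral_le_of_slack hF hG hH hle hH0, fun h hex => ?_⟩
  filter_upwards [ae_eq_of_integral_le hF hG hH hle hH0 h, hK, c.g₁_pos, c.g₂_pos,
    c.no_tie l₁ l₂ hl₁ hl₂, hex] with x h0 hx ha hb htie hor
  have hq₁ := hQ₁.2.1 x
  have hq₂ := hQ₂.2.1 x
  have hp₁ := hP₁.2.1 x
  have hp₂ := hP₂.2.1 x
  have hN := c.N_pos
  obtain ⟨k1, k2, k3, k4⟩ := hx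
  have hsl := sum_slack_le hN ha hb hl₁ hl₂ hp₁ hp₂ hq₁ hq₂ k1 k2 k3 k4
  have hs : Q₁ x * c.g₁ x + Q₂ x * c.g₂ x = P₁ x * c.g₁ x + P₂ x * c.g₂ x := by
    by_contra hne
    exact ((gaussRate_sub_lt hN (by positivity) (by positivity) hne).trans_le
      (mul_le_mul_of_nonneg_left hsl rateScale_pos.le)).ne h0
  have hz : (Q₁ x - P₁ x) / l₁ + (Q₂ x - P₂ x) / l₂ = 0 := by
    rw [hs, sub_self] at h0
    rcases mul_eq_zero.1 h0.symm with h | h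
    · exact absurd h rateScale_pos.ne'
    · exact h
  have hT : 0 < c.N + (P₁ x * c.g₁ x + P₂ x * c.g₂ x) := by positivity
  have hz' : (Q₁ x - P₁ x) * l₂ + (Q₂ x - P₂ x) * l₁ = 0 := by
    field_simp at hz
    linarith
  have hs' : (Q₁ x - P₁ x) * c.g₁ x + (Q₂ x - P₂ x) * c.g₂ x = 0 := by linarith
  have hdet : (Q₁ x - P₁ x) * (l₁ * c.g₁ x - l₂ * c.g₂ x) = 0 := by
    linear_combination l₁ * hs' - c.g₂ x * hz'
  have e1 : Q₁ x - P₁ x = 0 := by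
    rcases mul_eq_zero.1 hdet with h | h
    · exact h
    · exact absurd (by linarith) htie
  have e2 : Q₂ x - P₂ x = 0 := by
    rw [e1, zero_mul, zero_add] at hs'
    rcases mul_eq_zero.1 hs' with h | h
    · exact h
    · exact absurd h hb.ne'
  exact ⟨by linarith, by linarith⟩

/-- At the levels `l₁, l₂`, user 1 transmits only in the states where `l₂ g₂ < l₁ g₁`. -/
noncomputable def exclusive (l₁ l₂ : ℝ) (x : Ω) : ℝ :=
  if l₂ * c.g₂ x < l₁ * c.g₁ x then waterFill c.N (c.g₁ x) l₁ else 0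

theorem exclusive_nonneg (l₁ l₂ : ℝ) (x : Ω) : 0 ≤ c.exclusive l₁ l₂ x := by
  unfold exclusive
  split_ifs
  · exact waterFill_nonneg _ _ _
  · exact le_rfl

theorem exclusive_le {l₁ l₂ : ℝ} (hl₁ : 0 ≤ l₁) (x : Ω) : c.exclusive l₁ l₂ x ≤ l₁ := by
  unfold exclusive
  split_ifs
  · exact waterFill_le c.N_pos.le hl₁
  · exact hl₁

theorem measurable_exclusive (l₁ l₂ : ℝ) : Measurable (c.exclusive l₁ l₂) := by
  have h1 := c.measurable_g₁
  have h2 := c.measurable_g₂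
  exact Measurable.ite (measurableSet_lt (by fun_prop) (by fun_prop))
    (measurable_waterFill measurable_const h1 l₁) measurable_const

theorem integrable_exclusive {l₁ l₂ : ℝ} (hl₁ : 0 ≤ l₁) :
    Integrable (c.exclusive l₁ l₂) c.μ := by
  refine Integrable.mono' (integrable_const l₁) (c.measurable_exclusive l₁ l₂).aestronglyMeasurable
    (Eventually.of_forall fun x => ?_)
  rw [Real.norm_of_nonneg (c.exclusive_nonneg _ _ _)]
  exact c.exclusive_le hl₁ x

theorem exclusive_zero (l₁ l₂ : ℝ) (x : Ω) :
    c.exclusive l₁ l₂ x = 0 ∨ c.swap.exclusive l₂ l₁ x = 0 := by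
  by_cases h : l₂ * c.g₂ x < l₁ * c.g₁ x
  · right
    exact if_neg (not_lt.2 h.le)
  · left
    exact if_neg h

/-- The total received power under exclusive water-filling. -/
theorem noise_add_exclusive {l₁ l₂ : ℝ} {x : Ω}
    (h1 : 0 < c.g₁ x) (h2 : 0 < c.g₂ x) (hne : l₁ * c.g₁ x ≠ l₂ * c.g₂ x) :
    c.N + (c.exclusive l₁ l₂ x * c.g₁ x + c.swap.exclusive l₂ l₁ x * c.g₂ x)
      = max c.N (max (l₁ * c.g₁ x) (l₂ * c.g₂ x)) := by
  have key : ∀ {g l : ℝ}, 0 < g → c.N + waterFill c.N g l * g = max c.N (l * g) := by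
    intro g l hg
    rw [waterFill, if_pos hg, max_mul_of_nonneg _ _ hg.le, zero_mul, sub_mul,
      div_mul_cancel₀ _ hg.ne', ← max_add_add_left, max_comm]
    congr 1 <;> ring
  rcases lt_or_gt_of_ne hne with h | h
  · have e1 : c.exclusive l₁ l₂ x = 0 := if_neg (not_lt.2 h.le)
    have e2 : c.swap.exclusive l₂ l₁ x = waterFill c.N (c.g₂ x) l₂ := if_pos h
    rw [e1, e2, zero_mul, zero_add, key h2, max_eq_right h.le]
  · have e1 : c.exclusive l₁ l₂ x = waterFill c.N (c.g₁ x) l₁ := if_pos h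
    have e2 : c.swap.exclusive l₂ l₁ x = 0 := if_neg (not_lt.2 h.le)
    rw [e1, e2, zero_mul, add_zero, key h1, max_eq_left h.le]

theorem exclusive_pos {l₁ l₂ : ℝ} {x : Ω} (h1 : 0 < c.g₁ x) (h : 0 < c.exclusive l₁ l₂ x) :
    c.N ≤ l₁ * c.g₁ x ∧ l₂ * c.g₂ x < l₁ * c.g₁ x := by
  unfold exclusive at h
  split_ifs at h with hlt
  · have := level_eq_of_waterFill_pos h1 h
    exact ⟨by nlinarith [mul_pos h h1], hlt⟩
  · exact absurd h (lt_irrefl _)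

/-- Noise plus received power equals `max N (max (l₁ g₁) (l₂ g₂))` off ties, and a transmitting user
is the one whose term attains this maximum. -/
theorem sumKKT_exclusive {l₁ l₂ : ℝ} (hl₁ : 0 < l₁) (hl₂ : 0 < l₂) :
    c.SumKKT l₁ l₂ (c.exclusive l₁ l₂) (c.swap.exclusive l₂ l₁) := by
  filter_upwards [c.g₁_pos, c.g₂_pos, c.no_tie l₁ l₂ hl₁ hl₂] with x h1 h2 hne
  rw [c.noise_add_exclusive h1 h2 hne]
  refine ⟨le_max_of_le_right (le_max_left _ _), le_max_of_le_right (le_max_right _ _), ?_, ?_⟩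
  · intro h
    obtain ⟨e1, e2⟩ := c.exclusive_pos h1 h
    rw [max_eq_left e2.le, max_eq_right e1]
  · intro h
    obtain ⟨e1, e2⟩ := c.swap.exclusive_pos h2 h
    rw [max_eq_right (show l₁ * c.g₁ x ≤ l₂ * c.g₂ x from e2.le)]
    exact max_eq_right e1

theorem exclusive_mem_policies {l₁ l₂ B : ℝ} (hl₁ : 0 ≤ l₁)
    (h : ∫ x, c.exclusive l₁ l₂ x ∂c.μ ≤ B) : c.exclusive l₁ l₂ ∈ policies c.μ B :=
  ⟨c.measurable_exclusive l₁ l₂, c.exclusive_nonneg l₁ l₂, c.integrable_exclusive hl₁, h⟩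

/-! ### The Lagrangian dual -/

/-- Rate minus priced power, where the prices are the inverse water levels `l₁⁻¹, l₂⁻¹`. -/
noncomputable def lagrangian (l₁ l₂ : ℝ) (P₁ P₂ : Ω → ℝ) (x : Ω) : ℝ :=
  gaussRate ((P₁ x * c.g₁ x + P₂ x * c.g₂ x) / c.N)
    - (2 * Real.log 2)⁻¹ * (P₁ x / l₁ + P₂ x / l₂)

/-- At fixed prices the problem decouples over states, and in each one exclusive water-filling
satisfies the conditions that are sufficient for this concave function. -/
theorem lagrangian_le {l₁ l₂ : ℝ} (hl₁ : 0 < l₁) (hl₂ : 0 < l₂) {Q₁ Q₂ : Ω → ℝ}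
    (hQ₁ : ∀ x, 0 ≤ Q₁ x) (hQ₂ : ∀ x, 0 ≤ Q₂ x) : ∀ᵐ x ∂c.μ, c.lagrangian l₁ l₂ Q₁ Q₂ x
      ≤ c.lagrangian l₁ l₂ (c.exclusive l₁ l₂) (c.swap.exclusive l₂ l₁) x := by
  filter_upwards [c.sumKKT_exclusive hl₁ hl₂, c.g₁_pos, c.g₂_pos] with x hx ha hb
  have hq₁ := hQ₁ x
  have hq₂ := hQ₂ x
  have hp₁ := c.exclusive_nonneg l₁ l₂ x
  have hp₂ := c.swap.exclusive_nonneg l₂ l₁ x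
  have h1 := (gaussRate_sub_le c.N_pos
    (show 0 ≤ c.exclusive l₁ l₂ x * c.g₁ x + c.swap.exclusive l₂ l₁ x * c.g₂ x by positivity)
    (show 0 ≤ Q₁ x * c.g₁ x + Q₂ x * c.g₂ x by positivity)).trans
    (mul_le_mul_of_nonneg_left (sum_slack_le c.N_pos ha hb hl₁ hl₂ hp₁ hp₂ hq₁ hq₂
      hx.1 hx.2.1 hx.2.2.1 hx.2.2.2) rateScale_pos.le)
  unfold lagrangian
  rw [sub_div, sub_div] at h1
  linarith

theorem integrable_lagrangian (l₁ l₂ : ℝ) {P₁ P₂ : Ω → ℝ} {A B : ℝ}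
    (h1 : P₁ ∈ policies c.μ A) (h2 : P₂ ∈ policies c.μ B) :
    Integrable (c.lagrangian l₁ l₂ P₁ P₂) c.μ :=
  (c.integrable_sumRate h1 h2).sub
    (((h1.2.2.1.div_const l₁).add (h2.2.2.1.div_const l₂)).const_mul _)

/-- The dual function. -/
noncomputable def dual (l₁ l₂ : ℝ) : ℝ :=
  ∫ x, c.lagrangian l₁ l₂ (c.exclusive l₁ l₂) (c.swap.exclusive l₂ l₁) x ∂c.μ
    + (2 * Real.log 2)⁻¹ * (c.B₁ / l₁ + c.B₂ / l₂)

theorem dual_swap (l₁ l₂ : ℝ) : c.swap.dual l₂ l₁ = c.dual l₁ l₂ := by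
  unfold dual lagrangian
  congr 1
  · congr 1
    ext x
    rw [add_comm (c.swap.exclusive l₂ l₁ x * c.swap.g₁ x), add_comm (c.swap.exclusive l₂ l₁ x / l₂)]
    rfl
  · rw [add_comm (c.swap.B₁ / l₂)]
    rfl

theorem integrable_lagrangian_exclusive {l₁ l₂ : ℝ} (m₁ m₂ : ℝ) (hl₁ : 0 < l₁) (hl₂ : 0 < l₂) :
    Integrable (c.lagrangian m₁ m₂ (c.exclusive l₁ l₂) (c.swap.exclusive l₂ l₁)) c.μ :=
  c.integrable_lagrangian m₁ m₂ (c.exclusive_mem_policies hl₁.le le_rfl)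
    (c.swap.exclusive_mem_policies hl₂.le le_rfl)

theorem const_mem_policies {t : ℝ} (ht : 0 ≤ t) : (fun _ => t) ∈ policies c.μ t :=
  ⟨measurable_const, fun _ => ht, integrable_const _, by simp⟩

/-- Constant powers serve as test policies bounding the dual function from below: zero power
controls small levels, a large power controls large levels. -/
theorem integral_lagrangian_const_le {l₁ l₂ s t : ℝ} (hl₁ : 0 < l₁) (hl₂ : 0 < l₂) (hs : 0 ≤ s)
    (ht : 0 ≤ t) : ∫ x, c.lagrangian l₁ l₂ (fun _ => s) (fun _ => t) x ∂c.μ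
      ≤ ∫ x, c.lagrangian l₁ l₂ (c.exclusive l₁ l₂) (c.swap.exclusive l₂ l₁) x ∂c.μ :=
  integral_mono_ae
    (c.integrable_lagrangian l₁ l₂ (c.const_mem_policies hs) (c.const_mem_policies ht))
    (c.integrable_lagrangian_exclusive l₁ l₂ hl₁ hl₂)
    (c.lagrangian_le hl₁ hl₂ (fun _ => hs) (fun _ => ht))

theorem price_le_dual {l₁ l₂ : ℝ} (hl₁ : 0 < l₁) (hl₂ : 0 < l₂) :
    (2 * Real.log 2)⁻¹ * (c.B₁ / l₁) ≤ c.dual l₁ l₂ := by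
  have h := c.integral_lagrangian_const_le hl₁ hl₂ le_rfl le_rfl
  have h0 : ∫ x, c.lagrangian l₁ l₂ (fun _ => 0) (fun _ => 0) x ∂c.μ = 0 := by
    simp [lagrangian]
  rw [h0] at h
  have h2 := mul_nonneg rateScale_pos.le (div_nonneg c.B₂_pos.le hl₂.le)
  unfold dual
  rw [mul_add]
  linarith

/-- Testing with constant power `t ≤ l₁` for user 1 and silence for user 2 costs at most one unit of
`t / l₁`, while the rate grows like `log t` on a set where `g₁` is bounded away from zero. The bound
is uniform in `l₂`. -/
theorem exists_lt_dual (m : ℝ) : ∃ t, 0 < t ∧ ∀ l₁ l₂, t ≤ l₁ → 0 < l₂ → m < c.dual l₁ l₂ := by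
  have hN := c.N_pos
  have hκ := rateScale_pos
  obtain ⟨K, hK⟩ : ∃ K : ℕ, c.μ {x | 1 / ((K : ℝ) + 1) ≤ c.g₁ x} ≠ 0 := by
    by_contra! hcon
    have hU : c.μ (⋃ K : ℕ, {x | 1 / ((K : ℝ) + 1) ≤ c.g₁ x}) = 0 := measure_iUnion_null hcon
    have hall : ∀ᵐ x ∂c.μ, False := by
      filter_upwards [c.g₁_pos, measure_eq_zero_iff_ae_notMem.1 hU] with x hx hn
      obtain ⟨K, hK⟩ := exists_nat_one_div_lt hx
      exact hn (mem_iUnion.2 ⟨K, hK.le⟩)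
    have := hall.exists
    simp at this
  set ε : ℝ := 1 / ((K : ℝ) + 1) with hε
  have hε0 : 0 < ε := by positivity
  set S := {x | ε ≤ c.g₁ x} with hS
  have hSm : MeasurableSet S := measurableSet_le measurable_const c.measurable_g₁
  have hSp : 0 < c.μ.real S := ENNReal.toReal_pos hK (measure_ne_top _ _)
  have htend : Tendsto (fun t : ℝ => c.μ.real S * gaussRate (t * ε / c.N)) atTop atTop := by
    refine Tendsto.const_mul_atTop hSp ?_
    simp only [gaussRate_eq]
    refine Tendsto.const_mul_atTop hκ (Real.tendsto_log_atTop.comp ?_)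
    refine tendsto_atTop_add_const_left _ _ ?_
    refine Tendsto.atTop_div_const hN ?_
    exact Tendsto.atTop_mul_const hε0 tendsto_id
  obtain ⟨t, htm, ht0⟩ := ((htend.eventually_gt_atTop (m + (2 * Real.log 2)⁻¹)).and
    (eventually_gt_atTop 0)).exists
  refine ⟨t, ht0, fun l₁ l₂ h1 hl₂ => ?_⟩
  have hl₁ : 0 < l₁ := ht0.trans_le h1
  have h := c.integral_lagrangian_const_le hl₁ hl₂ ht0.le le_rfl
  have hlow : c.μ.real S * gaussRate (t * ε / c.N) - (2 * Real.log 2)⁻¹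
      ≤ ∫ x, c.lagrangian l₁ l₂ (fun _ => t) (fun _ => 0) x ∂c.μ := by
    have hi : Integrable (fun x => S.indicator (fun _ => gaussRate (t * ε / c.N)) x
        - (2 * Real.log 2)⁻¹) c.μ :=
      ((integrable_const _).indicator hSm).sub (integrable_const _)
    have he : ∫ x, (S.indicator (fun _ => gaussRate (t * ε / c.N)) x - (2 * Real.log 2)⁻¹) ∂c.μ
        = c.μ.real S * gaussRate (t * ε / c.N) - (2 * Real.log 2)⁻¹ := by
      rw [integral_sub ((integrable_const _).indicator hSm) (integrable_const _),
        integral_indicator_const _ hSm, smul_eq_mul]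
      simp
    rw [← he]
    refine integral_mono_ae hi (c.integrable_lagrangian l₁ l₂ (c.const_mem_policies ht0.le)
      (c.const_mem_policies le_rfl)) ?_
    filter_upwards [c.g₁_pos] with x hx
    unfold lagrangian
    have h2 : (2 * Real.log 2)⁻¹ * (t / l₁ + 0 / l₂) ≤ (2 * Real.log 2)⁻¹ := by
      rw [zero_div, add_zero]
      exact mul_le_of_le_one_right hκ.le ((div_le_one hl₁).2 h1)
    have h3 : S.indicator (fun _ => gaussRate (t * ε / c.N)) x
        ≤ gaussRate ((t * c.g₁ x + 0 * c.g₂ x) / c.N) := by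
      rw [zero_mul, add_zero]
      by_cases hxS : x ∈ S
      · rw [indicator_of_mem hxS]
        have : ε ≤ c.g₁ x := hxS
        exact gaussRate_le (by positivity) (by gcongr)
      · rw [indicator_of_notMem hxS]
        exact gaussRate_nonneg (by positivity)
    linarith
  have h4 : 0 ≤ (2 * Real.log 2)⁻¹ * (c.B₁ / l₁ + c.B₂ / l₂) :=
    mul_nonneg hκ.le (add_nonneg (div_nonneg c.B₁_pos.le hl₁.le) (div_nonneg c.B₂_pos.le hl₂.le))
  unfold dual
  linarith

/-- The exclusive policy jumps only at ties. These are null, so its averages depend continuously on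
the levels. -/
theorem continuousAt_exclusive {p : ℝ × ℝ} {x : Ω} (hne : p.1 * c.g₁ x ≠ p.2 * c.g₂ x) :
    ContinuousAt (fun q : ℝ × ℝ => c.exclusive q.1 q.2 x) p := by
  have hw : Continuous fun q : ℝ × ℝ => waterFill c.N (c.g₁ x) q.1 := by
    unfold waterFill
    split_ifs <;> fun_prop
  have hc1 : Continuous fun q : ℝ × ℝ => q.1 * c.g₁ x := by fun_prop
  have hc2 : Continuous fun q : ℝ × ℝ => q.2 * c.g₂ x := by fun_prop
  rcases lt_or_gt_of_ne hne with h | h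
  · refine (continuousAt_const (y := (0 : ℝ))).congr ?_
    filter_upwards [hc1.continuousAt.eventually_lt hc2.continuousAt h] with q hq
    exact (if_neg (not_lt.2 hq.le)).symm
  · refine hw.continuousAt.congr ?_
    filter_upwards [hc2.continuousAt.eventually_lt hc1.continuousAt h] with q hq
    exact (if_pos hq).symm

theorem continuousAt_integral_exclusive {p : ℝ × ℝ} (h1 : 0 < p.1) (h2 : 0 < p.2) :
    ContinuousAt (fun q : ℝ × ℝ => ∫ x, c.exclusive q.1 q.2 x ∂c.μ) p := by
  have hc : Continuous fun q : ℝ × ℝ => q.1 := continuous_fst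
  refine tendsto_integral_filter_of_dominated_convergence (fun _ => p.1 + 1) ?_ ?_
    (integrable_const _) ?_
  · exact Eventually.of_forall fun q => (c.measurable_exclusive q.1 q.2).aestronglyMeasurable
  · filter_upwards [hc.continuousAt.eventually_lt_const (lt_add_one p.1),
      hc.continuousAt.eventually_const_lt h1] with q hq hq0
    refine Eventually.of_forall fun x => ?_
    rw [Real.norm_of_nonneg (c.exclusive_nonneg _ _ _)]
    exact (c.exclusive_le hq0.le x).trans hq.le
  · filter_upwards [c.no_tie p.1 p.2 h1 h2] with x hx
    exact c.continuousAt_exclusive hx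

theorem continuous_gaussRate_max : Continuous fun x => gaussRate (max x 0) := by
  simp only [gaussRate_eq]
  refine continuous_const.mul (Continuous.log (by fun_prop) fun x => ?_)
  have := le_max_right x 0
  positivity

theorem continuousAt_dual {p : ℝ × ℝ} (h1 : 0 < p.1) (h2 : 0 < p.2) :
    ContinuousAt (fun q : ℝ × ℝ => c.dual q.1 q.2) p := by
  have hκ := rateScale_pos
  have hN := c.N_pos
  have hc1 : Continuous fun q : ℝ × ℝ => q.1 := continuous_fst
  have hc2 : Continuous fun q : ℝ × ℝ => q.2 := continuous_snd
  refine ContinuousAt.add ?_ ?_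
  swap
  · exact continuousAt_const.mul ((continuousAt_const.div hc1.continuousAt h1.ne').add
      (continuousAt_const.div hc2.continuousAt h2.ne'))
  set t := max (p.1 + 1) (p.2 + 1) with ht
  have ht1 : p.1 < t := (lt_add_one _).trans_le (le_max_left _ _)
  have ht2 : p.2 < t := (lt_add_one _).trans_le (le_max_right _ _)
  have ht0 : 0 < t := h1.trans ht1
  refine tendsto_integral_filter_of_dominated_convergence
    (fun x => gaussRate ((t * c.g₁ x + t * c.g₂ x) / c.N) + (2 * Real.log 2)⁻¹ * 2) ?_ ?_ ?_ ?_
  · filter_upwards [hc1.continuousAt.eventually_const_lt h1,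
      hc2.continuousAt.eventually_const_lt h2] with q hq1 hq2
    exact (c.integrable_lagrangian_exclusive q.1 q.2 hq1 hq2).aestronglyMeasurable
  · filter_upwards [hc1.continuousAt.eventually_const_lt h1,
      hc2.continuousAt.eventually_const_lt h2, hc1.continuousAt.eventually_lt_const ht1,
      hc2.continuousAt.eventually_lt_const ht2] with q hq1 hq2 hq3 hq4
    filter_upwards [c.g₁_pos, c.g₂_pos] with x hx1 hx2
    have e1 := c.exclusive_nonneg q.1 q.2 x
    have e2 := c.swap.exclusive_nonneg q.2 q.1 x
    have e3 := c.exclusive_le (l₂ := q.2) hq1.le x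
    have e4 := c.swap.exclusive_le (l₂ := q.1) hq2.le x
    have e5 : gaussRate ((c.exclusive q.1 q.2 x * c.g₁ x
        + c.swap.exclusive q.2 q.1 x * c.g₂ x) / c.N)
        ≤ gaussRate ((t * c.g₁ x + t * c.g₂ x) / c.N) := by
      refine gaussRate_le (by positivity) ?_
      have e6 : c.exclusive q.1 q.2 x ≤ t := e3.trans hq3.le
      have e7 : c.swap.exclusive q.2 q.1 x ≤ t := e4.trans hq4.le
      gcongr
    have e8 : 0 ≤ gaussRate ((c.exclusive q.1 q.2 x * c.g₁ x
        + c.swap.exclusive q.2 q.1 x * c.g₂ x) / c.N) := gaussRate_nonneg (by positivity)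
    have e9 : c.exclusive q.1 q.2 x / q.1 + c.swap.exclusive q.2 q.1 x / q.2 ≤ 2 := by
      have := (div_le_one hq1).2 e3
      have := (div_le_one hq2).2 e4
      linarith
    have e10 : 0 ≤ c.exclusive q.1 q.2 x / q.1 + c.swap.exclusive q.2 q.1 x / q.2 := by positivity
    have e11 := mul_le_mul_of_nonneg_left e9 hκ.le
    have e12 := mul_nonneg hκ.le e10
    rw [Real.norm_eq_abs, abs_le]
    unfold lagrangian
    constructor <;> linarith
  · exact (c.integrable_sumRate (c.const_mem_policies ht0.le) (c.const_mem_policies ht0.le)).add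
      (integrable_const _)
  · filter_upwards [c.no_tie p.1 p.2 h1 h2, c.g₁_pos, c.g₂_pos] with x hx hx1 hx2
    have d1 := c.continuousAt_exclusive hx
    have d2 : ContinuousAt (fun q : ℝ × ℝ => c.swap.exclusive q.2 q.1 x) p :=
      ContinuousAt.comp (f := Prod.swap) (x := p)
        (g := fun q : ℝ × ℝ => c.swap.exclusive q.1 q.2 x)
        (c.swap.continuousAt_exclusive (p := p.swap) hx.symm) continuous_swap.continuousAt
    have d3 : ContinuousAt (fun q : ℝ × ℝ => (c.exclusive q.1 q.2 x * c.g₁ x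
        + c.swap.exclusive q.2 q.1 x * c.g₂ x) / c.N) p :=
      ((d1.mul continuousAt_const).add (d2.mul continuousAt_const)).div_const _
    have d4 : ContinuousAt (fun q : ℝ × ℝ => gaussRate ((c.exclusive q.1 q.2 x * c.g₁ x
        + c.swap.exclusive q.2 q.1 x * c.g₂ x) / c.N)) p := by
      refine (ContinuousAt.comp (x := p) continuous_gaussRate_max.continuousAt d3).congr
        (Eventually.of_forall fun q => ?_)
      have e1 := c.exclusive_nonneg q.1 q.2 x
      have e2 := c.swap.exclusive_nonneg q.2 q.1 x
      simp only [Function.comp_apply]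
      rw [max_eq_left (by positivity)]
    exact d4.sub (continuousAt_const.mul ((d1.div hc1.continuousAt h1.ne').add
      (d2.div hc2.continuousAt h2.ne')))

/-- Levels whose dual value is at most that at `(1, 1)` lie in a compact box inside the open
quadrant: `price_le_dual` bounds them below and `exists_lt_dual` above. -/
theorem exists_dual_minimizer : ∃ l₁ l₂, 0 < l₁ ∧ 0 < l₂ ∧
    ∀ m₁ m₂, 0 < m₁ → 0 < m₂ → c.dual l₁ l₂ ≤ c.dual m₁ m₂ := by
  have hκ := rateScale_pos
  obtain ⟨t₁, ht₁, hd₁⟩ := c.exists_lt_dual (c.dual 1 1)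
  obtain ⟨t₂, ht₂, hd₂⟩ := c.swap.exists_lt_dual (c.dual 1 1)
  have hd1 : 0 < c.dual 1 1 := (mul_pos hκ (div_pos c.B₁_pos one_pos)).trans_le
    (c.price_le_dual one_pos one_pos)
  set s₁ := (2 * Real.log 2)⁻¹ * c.B₁ / c.dual 1 1 with hs₁
  set s₂ := (2 * Real.log 2)⁻¹ * c.B₂ / c.dual 1 1 with hs₂
  have hs₁0 : 0 < s₁ := div_pos (mul_pos hκ c.B₁_pos) hd1
  have hs₂0 : 0 < s₂ := div_pos (mul_pos hκ c.B₂_pos) hd1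
  have low₁ : ∀ l₁ l₂, 0 < l₁ → 0 < l₂ → c.dual l₁ l₂ ≤ c.dual 1 1 → s₁ ≤ l₁ := by
    intro l₁ l₂ h1 h2 h
    have h3 := (c.price_le_dual h1 h2).trans h
    rw [← mul_div_assoc, div_le_iff₀ h1] at h3
    rw [hs₁, div_le_iff₀ hd1]
    linarith
  have low₂ : ∀ l₁ l₂, 0 < l₁ → 0 < l₂ → c.dual l₁ l₂ ≤ c.dual 1 1 → s₂ ≤ l₂ := by
    intro l₁ l₂ h1 h2 h
    have h3 := (c.swap.price_le_dual h2 h1).trans ((c.dual_swap l₁ l₂).le.trans h)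
    rw [← mul_div_assoc, div_le_iff₀ h2] at h3
    rw [hs₂, div_le_iff₀ hd1]
    exact h3.trans_eq (mul_comm _ _)
  have up₁ : ∀ l₁ l₂, 0 < l₁ → 0 < l₂ → c.dual l₁ l₂ ≤ c.dual 1 1 → l₁ ≤ t₁ := by
    intro l₁ l₂ h1 h2 h
    by_contra! hlt
    exact absurd h (not_le.2 (hd₁ l₁ l₂ hlt.le h2))
  have up₂ : ∀ l₁ l₂, 0 < l₁ → 0 < l₂ → c.dual l₁ l₂ ≤ c.dual 1 1 → l₂ ≤ t₂ := by
    intro l₁ l₂ h1 h2 h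
    by_contra! hlt
    have := hd₂ l₂ l₁ hlt.le h1
    rw [dual_swap] at this
    exact absurd h (not_le.2 this)
  have hcomp : IsCompact (Icc s₁ t₁ ×ˢ Icc s₂ t₂) := isCompact_Icc.prod isCompact_Icc
  have hmem : ((1 : ℝ), (1 : ℝ)) ∈ Icc s₁ t₁ ×ˢ Icc s₂ t₂ :=
    ⟨⟨low₁ 1 1 one_pos one_pos le_rfl, up₁ 1 1 one_pos one_pos le_rfl⟩,
      ⟨low₂ 1 1 one_pos one_pos le_rfl, up₂ 1 1 one_pos one_pos le_rfl⟩⟩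
  obtain ⟨p, hp, hmin⟩ := hcomp.exists_isMinOn ⟨_, hmem⟩
    (f := fun q : ℝ × ℝ => c.dual q.1 q.2) fun q hq =>
      (c.continuousAt_dual (hs₁0.trans_le hq.1.1) (hs₂0.trans_le hq.2.1)).continuousWithinAt
  refine ⟨p.1, p.2, hs₁0.trans_le hp.1.1, hs₂0.trans_le hp.2.1, fun m₁ m₂ h1 h2 => ?_⟩
  by_cases h : c.dual m₁ m₂ ≤ c.dual 1 1
  · exact isMinOn_iff.1 hmin (m₁, m₂) ⟨⟨low₁ _ _ h1 h2 h, up₁ _ _ h1 h2 h⟩,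
      ⟨low₂ _ _ h1 h2 h, up₂ _ _ h1 h2 h⟩⟩
  · exact (isMinOn_iff.1 hmin (1, 1) hmem).trans (not_le.1 h).le

/-- The maximizer at `(m, l₂)` is a test policy at `(l₁, l₂)`, where its Lagrangian changes only
through the price. This gives the sign of the budget surplus without differentiating the dual. -/
theorem dual_variation {l₁ l₂ m : ℝ} (hl₁ : 0 < l₁) (hl₂ : 0 < l₂) (hm : 0 < m)
    (hmin : c.dual l₁ l₂ ≤ c.dual m l₂) :
    (1 / m - 1 / l₁) * (∫ x, c.exclusive m l₂ x ∂c.μ - c.B₁) ≤ 0 := by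
  have hκ := rateScale_pos
  have hV := integral_mono_ae (c.integrable_lagrangian_exclusive l₁ l₂ hm hl₂)
    (c.integrable_lagrangian_exclusive l₁ l₂ hl₁ hl₂)
    (c.lagrangian_le hl₁ hl₂ (c.exclusive_nonneg m l₂) (c.swap.exclusive_nonneg l₂ m))
  have he : ∫ x, c.lagrangian l₁ l₂ (c.exclusive m l₂) (c.swap.exclusive l₂ m) x ∂c.μ
      = ∫ x, c.lagrangian m l₂ (c.exclusive m l₂) (c.swap.exclusive l₂ m) x ∂c.μ
        + (2 * Real.log 2)⁻¹ * (1 / m - 1 / l₁) * ∫ x, c.exclusive m l₂ x ∂c.μ := by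
    rw [← integral_const_mul, ← integral_add (c.integrable_lagrangian_exclusive m l₂ hm hl₂)
      ((c.integrable_exclusive hm.le).const_mul _)]
    congr 1
    ext x
    unfold lagrangian
    ring
  rw [he] at hV
  unfold dual at hmin
  have h : (2 * Real.log 2)⁻¹ * ((1 / m - 1 / l₁) * (∫ x, c.exclusive m l₂ x ∂c.μ - c.B₁)) ≤ 0 := by
    have h1 : c.B₁ / m = 1 / m * c.B₁ := by ring
    have h2 : c.B₁ / l₁ = 1 / l₁ * c.B₁ := by ring
    rw [h1, h2] at hmin
    linarith
  by_contra! hpos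
  exact absurd h (not_le.2 (mul_pos hκ hpos))

/-- Levels `m < l₁` spend at most `B₁` and levels `m > l₁` at least `B₁`; continuity closes the gap.
-/
theorem integral_exclusive_of_minimizer {l₁ l₂ : ℝ} (hl₁ : 0 < l₁) (hl₂ : 0 < l₂)
    (hmin : ∀ m, 0 < m → c.dual l₁ l₂ ≤ c.dual m l₂) :
    ∫ x, c.exclusive l₁ l₂ x ∂c.μ = c.B₁ := by
  have hcont : Tendsto (fun m => ∫ x, c.exclusive m l₂ x ∂c.μ) (𝓝 l₁)
      (𝓝 (∫ x, c.exclusive l₁ l₂ x ∂c.μ)) := by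
    have h : Tendsto (fun q : ℝ × ℝ => ∫ x, c.exclusive q.1 q.2 x ∂c.μ) (𝓝 (l₁, l₂))
        (𝓝 (∫ x, c.exclusive l₁ l₂ x ∂c.μ)) :=
      c.continuousAt_integral_exclusive (p := (l₁, l₂)) hl₁ hl₂
    have h2 : Tendsto (fun m : ℝ => (m, l₂)) (𝓝 l₁) (𝓝 (l₁, l₂)) :=
      (Continuous.prodMk_left l₂).tendsto l₁
    exact h.comp h2
  refine le_antisymm ?_ ?_
  · refine le_of_tendsto (hcont.mono_left nhdsWithin_le_nhds : Tendsto _ (𝓝[<] l₁) _) ?_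
    filter_upwards [self_mem_nhdsWithin, (Ioi_mem_nhds hl₁ |> mem_nhdsWithin_of_mem_nhds)]
      with m hm hm0
    have h := c.dual_variation hl₁ hl₂ hm0 (hmin m hm0)
    have h1 : 0 < 1 / m - 1 / l₁ := sub_pos.2 (one_div_lt_one_div_of_lt hm0 hm)
    by_contra! hlt
    exact absurd h (not_le.2 (mul_pos h1 (sub_pos.2 hlt)))
  · refine ge_of_tendsto (hcont.mono_left nhdsWithin_le_nhds : Tendsto _ (𝓝[>] l₁) _) ?_
    filter_upwards [self_mem_nhdsWithin] with m hm
    have hm0 : 0 < m := hl₁.trans hm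
    have h := c.dual_variation hl₁ hl₂ hm0 (hmin m hm0)
    have h1 : 1 / m - 1 / l₁ < 0 := sub_neg.2 (one_div_lt_one_div_of_lt hl₁ hm)
    by_contra! hlt
    exact absurd h (not_le.2 (mul_pos_of_neg_of_neg h1 (sub_neg.2 hlt)))

/-- Water levels at which exclusive water-filling meets both power budgets. -/
theorem exists_exclusive_levels : ∃ l₁ l₂, 0 < l₁ ∧ 0 < l₂ ∧
    ∫ x, c.exclusive l₁ l₂ x ∂c.μ = c.B₁ ∧ ∫ x, c.swap.exclusive l₂ l₁ x ∂c.μ = c.B₂ := by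
  obtain ⟨l₁, l₂, h1, h2, hmin⟩ := c.exists_dual_minimizer
  refine ⟨l₁, l₂, h1, h2, c.integral_exclusive_of_minimizer h1 h2 fun m hm => hmin m l₂ hm h2,
    c.swap.integral_exclusive_of_minimizer h2 h1 fun m hm => ?_⟩
  rw [dual_swap, dual_swap]
  exact hmin l₁ m h1 hm

/-! ### The sum-rate point -/

def IsSumPoint (R : ℝ × ℝ) : Prop := R ∈ c.region ∧ ∀ S ∈ c.region, S.1 + S.2 ≤ R.1 + R.2

theorem sumRate_eq_of_exclusive {P₁ P₂ : Ω → ℝ} {A B : ℝ}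
    (h1 : P₁ ∈ policies c.μ A) (h2 : P₂ ∈ policies c.μ B)
    (hex : ∀ᵐ x ∂c.μ, P₁ x = 0 ∨ P₂ x = 0) :
    c.sumRate P₁ P₂ = c.soloRate P₁ + c.swap.soloRate P₂ := by
  unfold sumRate soloRate
  refine Eq.trans ?_ (integral_add (c.integrable_soloRate h1) (c.swap.integrable_soloRate h2))
  refine integral_congr_ae ?_
  filter_upwards [hex] with x hx
  rcases hx with h | h
  · simp only [h, zero_mul, zero_add, zero_div, gaussRate_zero]
    rfl
  · simp only [h, zero_mul, add_zero, zero_div, gaussRate_zero]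

/-- The sum-rate point exists, is unique and is an equilibrium payoff. -/
theorem exists_unique_sumPoint : ∃ S, (∀ R, c.IsSumPoint R ↔ R = S) ∧
    ∃ D, MeasurableSet D ∧ ∃ P₁ P₂, c.IsNash D P₁ P₂ ∧
      S = (c.payoff D P₁ P₂, c.swap.payoff Dᶜ P₂ P₁) := by
  obtain ⟨l₁, l₂, hl₁, hl₂, hB₁, hB₂⟩ := c.exists_exclusive_levels
  have hP₁ := c.exclusive_mem_policies hl₁.le hB₁.le
  have hP₂ := c.swap.exclusive_mem_policies hl₂.le hB₂.le
  set P₁ := c.exclusive l₁ l₂ with hP₁def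
  set P₂ := c.swap.exclusive l₂ l₁ with hP₂def
  have hK : c.SumKKT l₁ l₂ P₁ P₂ := c.sumKKT_exclusive hl₁ hl₂
  have hex : ∀ᵐ x ∂c.μ, P₁ x = 0 ∨ P₂ x = 0 := Eventually.of_forall (c.exclusive_zero l₁ l₂)
  have hsum := c.sumRate_eq_of_exclusive hP₁ hP₂ hex
  have hopt := fun {Q₁ Q₂} (h1 : Q₁ ∈ policies c.μ c.B₁) (h2 : Q₂ ∈ policies c.μ c.B₂) =>
    c.sumRate_le_of_sumKKT hl₁ hl₂ hP₁ hP₂ h1 h2 hB₁ hB₂ hK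
  have hmem : (c.soloRate P₁, c.swap.soloRate P₂) ∈ c.region := by
    refine ⟨P₁, hP₁, P₂, hP₂, ?_, ?_, le_rfl, le_rfl, hsum.ge⟩
    · exact (c.payoff_nonneg ∅ hP₁ hP₂).trans_eq (c.payoff_empty _ _)
    · exact (c.swap.payoff_nonneg ∅ hP₂ hP₁).trans_eq (c.swap.payoff_empty _ _)
  have hS : c.IsSumPoint (c.soloRate P₁, c.swap.soloRate P₂) := by
    refine ⟨hmem, ?_⟩
    rintro R ⟨Q₁, hQ₁, Q₂, hQ₂, -, -, -, -, h⟩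
    exact h.trans ((hopt hQ₁ hQ₂).1.trans_eq hsum)
  refine ⟨(c.soloRate P₁, c.swap.soloRate P₂), fun R => ⟨fun hR => ?_, fun h => h ▸ hS⟩, ?_⟩
  · obtain ⟨⟨Q₁, hQ₁, Q₂, hQ₂, -, -, h1, h2, h3⟩, hmax⟩ := hR
    have h4 := hmax _ hmem
    simp only at h4
    have hQ := (hopt hQ₁ hQ₂).2 (by linarith) hex
    have e1 : c.soloRate Q₁ = c.soloRate P₁ := by
      refine integral_congr_ae ?_
      filter_upwards [hQ] with x hx
      simp only [hx.1]
    have e2 : c.swap.soloRate Q₂ = c.swap.soloRate P₂ := by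
      refine integral_congr_ae (μ := c.μ) ?_
      filter_upwards [hQ] with x hx
      simp only [hx.2]
    -- Each coordinate is at most a solo rate, and the sum of the coordinates reaches the sum of
    -- those solo rates.
    ext
    · simp only
      linarith
    · simp only
      linarith
  -- The silent user is decoded first: it would see interference but sends nothing, and the active
  -- user sees none. Both payoffs are therefore solo rates.
  · set D : Set Ω := {x | l₁ * c.g₁ x ≤ l₂ * c.g₂ x} with hD
    have hDm : MeasurableSet D := by
      have := c.measurable_g₁
      have := c.measurable_g₂
      exact measurableSet_le (by fun_prop) (by fun_prop)
    have hz₁ : ∀ x ∈ D, P₁ x = 0 := fun x hx => if_neg (not_lt.2 hx)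
    have hz₂ : ∀ x ∉ D, P₂ x = 0 := fun x hx => if_neg (not_lt.2 (not_le.1 hx).le)
    have hw₁ : ∀ᵐ x ∂c.μ, P₁ x = waterFill (c.noise D P₂ x) (c.g₁ x) l₁ := by
      filter_upwards [hK, c.g₁_pos, c.g₂_pos] with x hx ha hb
      by_cases hxD : x ∈ D
      · rw [c.noise_of_mem hxD]
        refine eq_waterFill ha (hP₁.2.1 x) ?_ ?_
        · linarith [hx.1]
        · intro h
          linarith [hx.2.2.1 h]
      · rw [c.noise_of_notMem hxD]
        have h0 := hz₂ x hxD
        obtain ⟨k1, -, k3, -⟩ := hx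
        rw [h0, zero_mul, add_zero] at k1 k3
        exact eq_waterFill ha (hP₁.2.1 x) k1 k3
    have hw₂ : ∀ᵐ x ∂c.swap.μ, P₂ x = waterFill (c.swap.noise Dᶜ P₁ x) (c.swap.g₁ x) l₂ := by
      filter_upwards [hK, c.g₁_pos, c.g₂_pos] with x hx ha hb
      by_cases hxD : x ∈ D
      · rw [c.swap.noise_of_notMem (by simpa using hxD)]
        have h0 := hz₁ x hxD
        obtain ⟨-, k2, -, k4⟩ := hx
        rw [h0, zero_mul, zero_add] at k2 k4
        exact eq_waterFill hb (hP₂.2.1 x) k2 k4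
      · rw [c.swap.noise_of_mem (by simpa using hxD)]
        have k2 : l₂ * c.g₂ x ≤ c.N + P₁ x * c.g₁ x + P₂ x * c.g₂ x := by linarith [hx.2.1]
        refine eq_waterFill hb (hP₂.2.1 x) k2 ?_
        intro h
        have k4 := hx.2.2.2 h
        exact Eq.trans (add_assoc _ _ _) k4
    refine ⟨D, hDm, P₁, P₂, ⟨hP₁, hP₂, ?_, ?_⟩, ?_⟩
    · rw [c.bestResponse_iff hDm hP₁ hP₂]
      exact ⟨l₁, hl₁, (integral_congr_ae hw₁).symm.trans hB₁, hw₁⟩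
    · refine (c.swap.bestResponse_iff hDm.compl hP₂ hP₁).2
        ⟨l₂, hl₂, (integral_congr_ae hw₂).symm.trans hB₂, hw₂⟩
    · ext
      · refine integral_congr_ae (Eventually.of_forall fun x => ?_)
        by_cases hxD : x ∈ D
        · simp only [hz₁ x hxD, zero_mul, zero_div]
        · simp only [c.noise_of_notMem hxD]
      · refine integral_congr_ae (μ := c.μ) (Eventually.of_forall fun x => ?_)
        by_cases hxD : x ∈ D
        · simp only [c.swap.noise_of_notMem (D := Dᶜ) (by simpa using hxD)]
        · simp only [hz₂ x hxD, zero_mul, zero_div]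

end TwoUserChannel

/-! ### Boundary points and supporting lines in the plane -/

/-- Moving along the diagonal increases the form, so no neighbourhood of `R` lies in `s`. Only `α +
β > 0` matters, which covers the forms `R₁`, `R₂` and `R₁ + R₂`. -/
theorem mem_frontier_of_maximal {s : Set (ℝ × ℝ)} {R : ℝ × ℝ} (hR : R ∈ s) {α β : ℝ}
    (hpos : 0 < α + β)
    (hmax : ∀ S ∈ s, α * S.1 + β * S.2 ≤ α * R.1 + β * R.2) : R ∈ frontier s := by
  refine ⟨subset_closure hR, fun hint => ?_⟩
  have hc : Tendsto (fun t : ℝ => (R.1 + t, R.2 + t)) (𝓝[>] 0) (𝓝 R) := by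
    have : Continuous fun t : ℝ => (R.1 + t, R.2 + t) := by fun_prop
    have h := this.tendsto 0
    simp only [add_zero] at h
    exact h.mono_left nhdsWithin_le_nhds
  obtain ⟨t, ht, ht0⟩ := ((hc.eventually (mem_interior_iff_mem_nhds.1 hint)).and
    self_mem_nhdsWithin).exists
  have h := hmax _ ht
  simp only at h
  have : 0 < (α + β) * t := mul_pos hpos ht0
  linarith

/-- A boundary point with positive coordinates of a convex set that is closed downwards in the
positive quadrant maximizes a nonzero linear form with nonnegative coefficients. -/
theorem exists_maximal_of_mem_frontier {s : Set (ℝ × ℝ)} (hs : Convex ℝ s)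
    (hdown : ∀ S ∈ s, ∀ T : ℝ × ℝ, 0 ≤ T.1 → 0 ≤ T.2 → T.1 ≤ S.1 → T.2 ≤ S.2 → T ∈ s)
    {R : ℝ × ℝ} (hR : R ∈ s) (h1 : 0 < R.1) (h2 : 0 < R.2) (hfr : R ∈ frontier s) :
    ∃ α β : ℝ, 0 ≤ α ∧ 0 ≤ β ∧ 0 < α + β ∧
      ∀ S ∈ s, α * S.1 + β * S.2 ≤ α * R.1 + β * R.2 := by
  -- A point of `s` strictly above `R` would put an open box around `R` into `s`; the box starts at
  -- the origin, so `R` must have positive coordinates.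
  have hdisj : Disjoint (Ioi R.1 ×ˢ Ioi R.2) s := by
    rw [disjoint_left]
    rintro S ⟨hS1, hS2⟩ hS
    refine hfr.2 (mem_interior.2 ⟨Ioo 0 S.1 ×ˢ Ioo 0 S.2, ?_, isOpen_Ioo.prod isOpen_Ioo,
      ⟨⟨h1, hS1⟩, ⟨h2, hS2⟩⟩⟩)
    rintro T ⟨hT1, hT2⟩
    exact hdown S hS T hT1.1.le hT2.1.le hT1.2.le hT2.2.le
  obtain ⟨f, u, hfu, huf⟩ := geometric_hahn_banach_open
    ((convex_Ioi R.1).prod (convex_Ioi R.2)) (isOpen_Ioi.prod isOpen_Ioi) hs hdisj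
  set p := f (1, 0) with hp
  set q := f (0, 1) with hq
  have hf : ∀ x y : ℝ, f (x, y) = x * p + y * q := by
    intro x y
    have : ((x, y) : ℝ × ℝ) = x • (1, 0) + y • (0, 1) := by simp
    rw [this, map_add, map_smul, map_smul, smul_eq_mul, smul_eq_mul]
  have hlt : ∀ a b, 0 < a → 0 < b → (R.1 + a) * p + (R.2 + b) * q < u := by
    intro a b ha hb
    rw [← hf]
    exact hfu _ ⟨by simpa using ha, by simpa using hb⟩
  have hRu : u ≤ R.1 * p + R.2 * q := by
    rw [← hf]
    exact huf R hR
  have hneg : ∀ a b, 0 < a → 0 < b → a * p + b * q < 0 := by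
    intro a b ha hb
    linarith [hlt a b ha hb]
  have hp0 : p ≤ 0 := by
    by_contra! h
    have h3 := hneg ((|q| + 1) / p) 1 (by positivity) one_pos
    rw [div_mul_cancel₀ _ h.ne'] at h3
    linarith [neg_abs_le q]
  have hq0 : q ≤ 0 := by
    by_contra! h
    have h3 := hneg 1 ((|p| + 1) / q) one_pos (by positivity)
    rw [div_mul_cancel₀ _ h.ne'] at h3
    linarith [neg_abs_le p]
  refine ⟨-p, -q, by linarith, by linarith, by linarith [hneg 1 1 one_pos one_pos], ?_⟩
  intro S hS
  have hSu : u ≤ S.1 * p + S.2 * q := by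
    rw [← hf]
    exact huf S hS
  by_contra! hcon
  have hd : 0 < 1 - p - q := by linarith
  set d := (R.1 * p + R.2 * q) - (S.1 * p + S.2 * q) with hddef
  have hd0 : 0 < d := by linarith
  -- This diagonal step lowers the form by strictly less than the gap `d`, so its value stays above
  -- the one at `S`, against the separation.
  have h3 := hlt (d / (1 - p - q)) (d / (1 - p - q)) (by positivity) (by positivity)
  have h4 : d / (1 - p - q) * (1 - p - q) = d := div_mul_cancel₀ _ hd.ne'
  have h5 : 0 < d / (1 - p - q) := by positivity
  nlinarith

/-! ### Convexity of the rate region -/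

namespace TwoUserChannel

variable {Ω : Type*} [MeasurableSpace Ω] (c : TwoUserChannel Ω)

theorem region_down {S : ℝ × ℝ} (hS : S ∈ c.region) (T : ℝ × ℝ) (h1 : 0 ≤ T.1) (h2 : 0 ≤ T.2)
    (h3 : T.1 ≤ S.1) (h4 : T.2 ≤ S.2) : T ∈ c.region := by
  obtain ⟨P₁, hP₁, P₂, hP₂, -, -, h5, h6, h7⟩ := hS
  exact ⟨P₁, hP₁, P₂, hP₂, h1, h2, h3.trans h5, h4.trans h6, (add_le_add h3 h4).trans h7⟩

theorem convex_policies (μ : Measure Ω) (B : ℝ) : Convex ℝ (policies μ B) := by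
  rintro P ⟨hP1, hP2, hP3, hP4⟩ Q ⟨hQ1, hQ2, hQ3, hQ4⟩ s t hs ht hst
  refine ⟨?_, fun x => ?_, ?_, ?_⟩
  · exact (hP1.const_smul s).add (hQ1.const_smul t)
  · exact add_nonneg (mul_nonneg hs (hP2 x)) (mul_nonneg ht (hQ2 x))
  · exact (hP3.smul s).add (hQ3.smul t)
  · have h : ∫ x, (s • P + t • Q) x ∂μ = s * ∫ x, P x ∂μ + t * ∫ x, Q x ∂μ := by
      rw [← integral_const_mul, ← integral_const_mul,
        ← integral_add (hP3.const_mul s) (hQ3.const_mul t)]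
      rfl
    rw [h]
    calc s * ∫ x, P x ∂μ + t * ∫ x, Q x ∂μ ≤ s * B + t * B := by gcongr
      _ = B := by rw [← add_mul, hst, one_mul]

theorem integral_gaussRate_concave {μ : Measure Ω} {U V W : Ω → ℝ} {s t : ℝ} (hs : 0 ≤ s)
    (ht : 0 ≤ t) (hst : s + t = 1) (hU : Integrable (fun x => gaussRate (U x)) μ)
    (hV : Integrable (fun x => gaussRate (V x)) μ) (hW : Integrable (fun x => gaussRate (W x)) μ)
    (h : ∀ᵐ x ∂μ, 0 ≤ U x ∧ 0 ≤ V x ∧ W x = s * U x + t * V x) :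
    s * ∫ x, gaussRate (U x) ∂μ + t * ∫ x, gaussRate (V x) ∂μ ≤ ∫ x, gaussRate (W x) ∂μ := by
  rw [← integral_const_mul, ← integral_const_mul,
    ← integral_add (hU.const_mul s) (hV.const_mul t)]
  refine integral_mono_ae ((hU.const_mul s).add (hV.const_mul t)) hW ?_
  filter_upwards [h] with x hx
  rw [hx.2.2]
  exact gaussRate_concave hx.1 hx.2.1 hs ht hst

theorem soloRate_concave {P Q : Ω → ℝ} {B s t : ℝ} (hP : P ∈ policies c.μ B)
    (hQ : Q ∈ policies c.μ B) (hs : 0 ≤ s) (ht : 0 ≤ t) (hst : s + t = 1) :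
    s * c.soloRate P + t * c.soloRate Q ≤ c.soloRate (s • P + t • Q) := by
  refine integral_gaussRate_concave hs ht hst (c.integrable_soloRate hP) (c.integrable_soloRate hQ)
    (c.integrable_soloRate (convex_policies c.μ B hP hQ hs ht hst)) ?_
  filter_upwards [c.g₁_pos] with x hx
  refine ⟨div_nonneg (mul_nonneg (hP.2.1 x) hx.le) c.N_pos.le,
    div_nonneg (mul_nonneg (hQ.2.1 x) hx.le) c.N_pos.le, ?_⟩
  simp only [Pi.add_apply, Pi.smul_apply, smul_eq_mul]
  ring

theorem sumRate_concave {P₁ Q₁ P₂ Q₂ : Ω → ℝ} {A B s t : ℝ} (hP₁ : P₁ ∈ policies c.μ A)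
    (hQ₁ : Q₁ ∈ policies c.μ A) (hP₂ : P₂ ∈ policies c.μ B) (hQ₂ : Q₂ ∈ policies c.μ B)
    (hs : 0 ≤ s) (ht : 0 ≤ t) (hst : s + t = 1) :
    s * c.sumRate P₁ P₂ + t * c.sumRate Q₁ Q₂
      ≤ c.sumRate (s • P₁ + t • Q₁) (s • P₂ + t • Q₂) := by
  refine integral_gaussRate_concave hs ht hst (c.integrable_sumRate hP₁ hP₂)
    (c.integrable_sumRate hQ₁ hQ₂)
    (c.integrable_sumRate (convex_policies c.μ A hP₁ hQ₁ hs ht hst)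
      (convex_policies c.μ B hP₂ hQ₂ hs ht hst)) ?_
  filter_upwards [c.g₁_pos, c.g₂_pos] with x hx1 hx2
  refine ⟨div_nonneg (add_nonneg (mul_nonneg (hP₁.2.1 x) hx1.le) (mul_nonneg (hP₂.2.1 x) hx2.le))
      c.N_pos.le,
    div_nonneg (add_nonneg (mul_nonneg (hQ₁.2.1 x) hx1.le) (mul_nonneg (hQ₂.2.1 x) hx2.le))
      c.N_pos.le, ?_⟩
  simp only [Pi.add_apply, Pi.smul_apply, smul_eq_mul]
  ring

/-- Averaging the power policies suffices, since all three rate bounds are concave in the powers. -/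
theorem convex_region : Convex ℝ c.region := by
  rintro R ⟨P₁, hP₁, P₂, hP₂, r1, r2, r3, r4, r5⟩ S ⟨Q₁, hQ₁, Q₂, hQ₂, s1, s2, s3, s4, s5⟩
    s t hs ht hst
  refine ⟨_, convex_policies c.μ c.B₁ hP₁ hQ₁ hs ht hst,
    _, convex_policies c.μ c.B₂ hP₂ hQ₂ hs ht hst, ?_, ?_, ?_, ?_, ?_⟩
  · exact add_nonneg (mul_nonneg hs r1) (mul_nonneg ht s1)
  · exact add_nonneg (mul_nonneg hs r2) (mul_nonneg ht s2)
  · exact (add_le_add (mul_le_mul_of_nonneg_left r3 hs) (mul_le_mul_of_nonneg_left s3 ht)).trans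
      (c.soloRate_concave hP₁ hQ₁ hs ht hst)
  · exact (add_le_add (mul_le_mul_of_nonneg_left r4 hs) (mul_le_mul_of_nonneg_left s4 ht)).trans
      (c.swap.soloRate_concave hP₂ hQ₂ hs ht hst)
  · refine le_trans ?_ ((add_le_add (mul_le_mul_of_nonneg_left r5 hs)
      (mul_le_mul_of_nonneg_left s5 ht)).trans
      (c.sumRate_concave hP₁ hQ₁ hP₂ hQ₂ hs ht hst))
    apply le_of_eq
    simp only [Prod.fst_add, Prod.snd_add, Prod.smul_fst, Prod.smul_snd, smul_eq_mul]
    ring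

theorem nash_payoff_pos {D : Set Ω} (hD : MeasurableSet D) {P₁ P₂ : Ω → ℝ}
    (h : c.IsNash D P₁ P₂) : 0 < c.payoff D P₁ P₂ ∧ 0 < c.swap.payoff Dᶜ P₂ P₁ :=
  ⟨c.payoff_pos_of_bestResponse hD h.1 h.2.1 h.2.2.1,
    c.swap.payoff_pos_of_bestResponse hD.compl h.2.1 h.1 h.2.2.2⟩

/-! ### Equilibria on the boundary -/

/-- `log (1 + y) ≥ y / (1 + y) ≥ y - 2 y ^ 2` for `|y| ≤ 1 / 2`. This converse of the tangent bound
yields first-order conditions without differentiation under the integral. -/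
theorem gaussRate_sub_ge {N x z : ℝ} (hN : 0 < N) (hx : 0 ≤ x)
    (hz : |z / (N + x)| ≤ 1 / 2) :
    (2 * Real.log 2)⁻¹ * (z / (N + x) - 2 * (z / (N + x)) ^ 2)
      ≤ gaussRate ((x + z) / N) - gaussRate (x / N) := by
  have hNx : 0 < N + x := by linarith
  set y := z / (N + x) with hy
  obtain ⟨hy1, hy2⟩ := abs_le.1 hz
  have hzy : z = y * (N + x) := (div_mul_cancel₀ _ hNx.ne').symm
  have h1y : 0 < 1 + y := by linarith
  have e1 : 1 + (x + z) / N = (1 + y) * (1 + x / N) := by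
    rw [hzy]
    field_simp
    ring
  rw [gaussRate_eq, gaussRate_eq, ← mul_sub, e1, Real.log_mul h1y.ne' (by positivity),
    add_sub_cancel_right]
  apply mul_le_mul_of_nonneg_left _ rateScale_pos.le
  refine le_trans ?_ (Real.one_sub_inv_le_log_of_pos h1y)
  have : 1 - (1 + y)⁻¹ = y / (1 + y) := by
    field_simp
    ring
  rw [this, le_div_iff₀ h1y]
  nlinarith [sq_nonneg y, mul_nonneg (sq_nonneg y) (show 0 ≤ 1 + 2 * y by linarith)]

/-- If `P₁` transmits with noise level `l₁ g₁` and maximizes a weighted sum of its own rate and of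
the sum rate, then its marginal sum rate is a.e. constant where it transmits. -/
theorem marginal_const {P₁ P₂ : Ω → ℝ} (hP₁ : P₁ ∈ policies c.μ c.B₁)
    (hP₂ : P₂ ∈ policies c.μ c.B₂) {l₁ α β : ℝ} (hl₁ : 0 < l₁) (hα : 0 ≤ α) (hβ : 0 < β)
    (hB : ∫ x, P₁ x ∂c.μ = c.B₁) (hle : ∀ᵐ x ∂c.μ, P₁ x ≤ l₁)
    (hlev : ∀ᵐ x ∂c.μ, 0 < P₁ x → c.N + P₁ x * c.g₁ x = l₁ * c.g₁ x)
    (hmax : ∀ Q ∈ policies c.μ c.B₁, α * c.soloRate Q + β * c.sumRate Q P₂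
      ≤ α * c.soloRate P₁ + β * c.sumRate P₁ P₂) :
    ∃ k, ∀ᵐ x ∂c.μ, 0 < P₁ x →
      c.g₁ x / (c.N + (P₁ x * c.g₁ x + P₂ x * c.g₂ x)) = k := by
  have hκ := rateScale_pos
  have hN := c.N_pos
  have hm1 := hP₁.1
  have hm2 := hP₂.1
  have hg1 := c.measurable_g₁
  have hg2 := c.measurable_g₂
  set m := 1 / l₁ with hm
  have hm0 : 0 < m := by positivity
  have hml : m * l₁ = 1 := by rw [hm]; field_simp
  -- The marginal sum rate, truncated to `[0, m]` so that it is bounded everywhere. Where user 1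
  -- transmits the truncation is inactive, because the total level is at least `l₁ g₁`.
  set w : Ω → ℝ := fun x => max 0 (min m (c.g₁ x / (c.N + (P₁ x * c.g₁ x + P₂ x * c.g₂ x))))
    with hw
  have hwm : Measurable w := by fun_prop
  have hw0 : ∀ x, 0 ≤ w x := fun x => le_max_left _ _
  have hw1 : ∀ x, w x ≤ m := fun x => max_le hm0.le (min_le_left _ _)
  have hPw : Integrable (fun x => P₁ x * w x) c.μ := by
    refine Integrable.mono' (hP₁.2.2.1.const_mul m) (by fun_prop) (Eventually.of_forall fun x => ?_)
    rw [Real.norm_of_nonneg (mul_nonneg (hP₁.2.1 x) (hw0 x)), mul_comm]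
    exact mul_le_mul_of_nonneg_right (hw1 x) (hP₁.2.1 x)
  -- The power-weighted mean of `w`: it gives `φ = P₁ (w - k)` mean zero, so adding `t φ` to `P₁`
  -- preserves the budget. The factor `P₁` keeps the powers nonnegative for small `t`.
  set k := (∫ x, P₁ x * w x ∂c.μ) / c.B₁ with hk
  have hkB : k * c.B₁ = ∫ x, P₁ x * w x ∂c.μ := div_mul_cancel₀ _ c.B₁_pos.ne'
  have hk0 : 0 ≤ k := div_nonneg (integral_nonneg fun x => mul_nonneg (hP₁.2.1 x) (hw0 x))
    c.B₁_pos.le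
  have hk1 : k ≤ m := by
    rw [hk, div_le_iff₀ c.B₁_pos, ← hB, ← integral_const_mul]
    refine integral_mono hPw (hP₁.2.2.1.const_mul m) fun x => ?_
    simp only
    rw [mul_comm]
    exact mul_le_mul_of_nonneg_right (hw1 x) (hP₁.2.1 x)
  have hwk : ∀ x, |w x - k| ≤ m := fun x => by
    rw [abs_le]
    constructor <;> linarith [hw0 x, hw1 x]
  set φ : Ω → ℝ := fun x => P₁ x * (w x - k) with hφ
  have hφi : Integrable φ c.μ := by
    have : φ = fun x => P₁ x * w x - k * P₁ x := by
      ext x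
      simp only [hφ]
      ring
    rw [this]
    exact hPw.sub (hP₁.2.2.1.const_mul k)
  have hφ0 : ∫ x, φ x ∂c.μ = 0 := by
    have : ∀ x, φ x = P₁ x * w x - k * P₁ x := fun x => by
      simp only [hφ]
      ring
    simp only [this]
    rw [integral_sub hPw (hP₁.2.2.1.const_mul k), integral_const_mul, hB, hkB, sub_self]
  have hsqi : Integrable (fun x => P₁ x * (w x - k) ^ 2) c.μ := by
    refine Integrable.mono' (hP₁.2.2.1.const_mul (m ^ 2))
      (Measurable.aestronglyMeasurable (by fun_prop)) (Eventually.of_forall fun x => ?_)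
    rw [Real.norm_of_nonneg (mul_nonneg (hP₁.2.1 x) (sq_nonneg _)), mul_comm]
    exact mul_le_mul_of_nonneg_right (sq_le_sq' (abs_le.1 (hwk x)).1 (abs_le.1 (hwk x)).2)
      (hP₁.2.1 x)
  have hwp : ∀ᵐ x ∂c.μ, 0 < P₁ x →
      w x = c.g₁ x / (c.N + (P₁ x * c.g₁ x + P₂ x * c.g₂ x)) := by
    filter_upwards [hlev, c.g₁_pos, c.g₂_pos] with x hx ha hb hp
    have hp2 := hP₂.2.1 x
    have hp1 := hP₁.2.1 x
    simp only [hw]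
    rw [max_eq_right (by positivity), min_eq_right]
    rw [hm, div_le_div_iff₀ (by positivity) hl₁]
    have := hx hp
    nlinarith [mul_nonneg hp2 hb.le]
  -- To first order the solo rate does not move, as its marginal is the constant `m` where user 1
  -- transmits and `φ` has mean zero; the sum rate gains `∫ w φ = ∫ P₁ (w - k) ^ 2`. Maximality
  -- bounds this gain by the quadratic error, and `t → 0` makes it vanish.
  have key : ∀ t, 0 < t → t ≤ l₁ / 2 →
      β * ∫ x, P₁ x * (w x - k) ^ 2 ∂c.μ ≤ t * (2 * (α + β) * m ^ 2) := by
    intro t ht htl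
    have htm : t * m ≤ 1 / 2 := by
      have := mul_le_mul_of_nonneg_right htl hm0.le
      linarith
    set Q : Ω → ℝ := fun x => P₁ x + t * φ x with hQ
    have hφle : ∀ x, |t * φ x| ≤ P₁ x / 2 := fun x => by
      simp only [hφ]
      rw [abs_mul, abs_mul, abs_of_pos ht, abs_of_nonneg (hP₁.2.1 x)]
      have h3 := mul_le_mul_of_nonneg_left ((mul_le_mul_of_nonneg_left (hwk x) ht.le).trans htm)
        (hP₁.2.1 x)
      linarith
    have hQp : Q ∈ policies c.μ c.B₁ := by
      refine ⟨by fun_prop, fun x => ?_, hP₁.2.2.1.add (hφi.const_mul t), ?_⟩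
      · have := (abs_le.1 (hφle x)).1
        have := hP₁.2.1 x
        simp only [hQ]
        linarith
      · simp only [hQ]
        rw [integral_add hP₁.2.2.1 (hφi.const_mul t), integral_const_mul, hφ0, mul_zero, add_zero,
          hB]
    have hmQ := hmax Q hQp
    have i1 := c.integrable_soloRate hQp
    have i2 := c.integrable_soloRate hP₁
    have i3 := c.integrable_sumRate hQp hP₂
    have i4 := c.integrable_sumRate hP₁ hP₂
    have hφm : ∀ᵐ x ∂c.μ, |φ x| ≤ 1 := by
      filter_upwards [hle] with x hx
      simp only [hφ]
      rw [abs_mul, abs_of_nonneg (hP₁.2.1 x)]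
      have := mul_le_mul hx (hwk x) (abs_nonneg _) hl₁.le
      linarith
    have b1 : ∀ᵐ x ∂c.μ, (2 * Real.log 2)⁻¹ * (t * m * φ x - 2 * (t * m) ^ 2)
        ≤ gaussRate (Q x * c.g₁ x / c.N) - gaussRate (P₁ x * c.g₁ x / c.N) := by
      filter_upwards [hlev, c.g₁_pos, hφm] with x hx ha hφx
      have hp1 := hP₁.2.1 x
      have hz : t * φ x * c.g₁ x / (c.N + P₁ x * c.g₁ x) = t * m * φ x := by
        rcases hp1.eq_or_lt with h | h
        · simp only [hφ, ← h, zero_mul, mul_zero, zero_div]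
        · rw [hx h, hm]
          field_simp
      have hab : |t * m * φ x| ≤ t * m := by
        rw [abs_mul, abs_of_pos (mul_pos ht hm0)]
        exact mul_le_of_le_one_right (by positivity) hφx
      have h := gaussRate_sub_ge (z := t * φ x * c.g₁ x) hN
        (show 0 ≤ P₁ x * c.g₁ x by positivity) (by rw [hz]; exact hab.trans htm)
      rw [hz] at h
      have e : Q x * c.g₁ x = P₁ x * c.g₁ x + t * φ x * c.g₁ x := by simp only [hQ]; ring
      rw [e]
      refine le_trans (mul_le_mul_of_nonneg_left ?_ hκ.le) h
      have := sq_le_sq' (abs_le.1 hab).1 (abs_le.1 hab).2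
      linarith
    have b2 : ∀ᵐ x ∂c.μ, (2 * Real.log 2)⁻¹ *
        (t * (P₁ x * (w x - k) ^ 2 + k * φ x) - 2 * (t * m) ^ 2)
        ≤ gaussRate ((Q x * c.g₁ x + P₂ x * c.g₂ x) / c.N)
          - gaussRate ((P₁ x * c.g₁ x + P₂ x * c.g₂ x) / c.N) := by
      filter_upwards [hwp, c.g₁_pos, c.g₂_pos, hφm] with x hx ha hb hφx
      have hp1 := hP₁.2.1 x
      have hp2 := hP₂.2.1 x
      have hz : t * φ x * c.g₁ x / (c.N + (P₁ x * c.g₁ x + P₂ x * c.g₂ x)) = t * w x * φ x := by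
        rcases hp1.eq_or_lt with h | h
        · simp only [hφ, ← h, zero_mul, mul_zero, zero_div]
        · rw [hx h]
          ring
      have hab : |t * w x * φ x| ≤ t * m := by
        rw [abs_mul, abs_of_nonneg (mul_nonneg ht.le (hw0 x))]
        exact (mul_le_of_le_one_right (mul_nonneg ht.le (hw0 x)) hφx).trans
          (mul_le_mul_of_nonneg_left (hw1 x) ht.le)
      have h := gaussRate_sub_ge (z := t * φ x * c.g₁ x) hN
        (show 0 ≤ P₁ x * c.g₁ x + P₂ x * c.g₂ x by positivity) (by rw [hz]; exact hab.trans htm)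
      rw [hz] at h
      have e : Q x * c.g₁ x + P₂ x * c.g₂ x
          = P₁ x * c.g₁ x + P₂ x * c.g₂ x + t * φ x * c.g₁ x := by simp only [hQ]; ring
      rw [e]
      refine le_trans (mul_le_mul_of_nonneg_left ?_ hκ.le) h
      have h5 := sq_le_sq' (abs_le.1 hab).1 (abs_le.1 hab).2
      have h6 : t * (P₁ x * (w x - k) ^ 2 + k * φ x) = t * w x * φ x := by
        simp only [hφ]
        ring
      linarith
    have j1 : Integrable (fun x => (2 * Real.log 2)⁻¹ * (t * m * φ x - 2 * (t * m) ^ 2)) c.μ :=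
      ((hφi.const_mul _).sub (integrable_const _)).const_mul _
    have j2a : Integrable (fun x => P₁ x * (w x - k) ^ 2 + k * φ x) c.μ :=
      hsqi.add (hφi.const_mul k)
    have j2 : Integrable (fun x => (2 * Real.log 2)⁻¹ *
        (t * (P₁ x * (w x - k) ^ 2 + k * φ x) - 2 * (t * m) ^ 2)) c.μ :=
      ((j2a.const_mul t).sub (integrable_const _)).const_mul _
    have k1 := integral_mono_ae j1 (i1.sub i2) b1
    have k2 := integral_mono_ae j2 (i3.sub i4) b2
    have v1 : ∫ x, (2 * Real.log 2)⁻¹ * (t * m * φ x - 2 * (t * m) ^ 2) ∂c.μ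
        = (2 * Real.log 2)⁻¹ * (-(2 * (t * m) ^ 2)) := by
      rw [integral_const_mul, integral_sub (hφi.const_mul _) (integrable_const _),
        integral_const_mul, hφ0]
      simp
    have v2 : ∫ x, (2 * Real.log 2)⁻¹ *
        (t * (P₁ x * (w x - k) ^ 2 + k * φ x) - 2 * (t * m) ^ 2) ∂c.μ
        = (2 * Real.log 2)⁻¹ * (t * ∫ x, P₁ x * (w x - k) ^ 2 ∂c.μ - 2 * (t * m) ^ 2) := by
      rw [integral_const_mul, integral_sub (j2a.const_mul t) (integrable_const _),
        integral_const_mul, integral_add hsqi (hφi.const_mul k), integral_const_mul, hφ0]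
      simp
    rw [v1, integral_sub' i1 i2] at k1
    rw [v2, integral_sub' i3 i4] at k2
    change _ ≤ c.soloRate Q - c.soloRate P₁ at k1
    change _ ≤ c.sumRate Q P₂ - c.sumRate P₁ P₂ at k2
    have k3 := mul_le_mul_of_nonneg_left k1 hα
    have k4 := mul_le_mul_of_nonneg_left k2 hβ.le
    have k5 : (2 * Real.log 2)⁻¹ * (t * (β * ∫ x, P₁ x * (w x - k) ^ 2 ∂c.μ
        - t * (2 * (α + β) * m ^ 2))) ≤ 0 := by
      have : (2 * Real.log 2)⁻¹ * (t * (β * ∫ x, P₁ x * (w x - k) ^ 2 ∂c.μ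
          - t * (2 * (α + β) * m ^ 2)))
          = α * ((2 * Real.log 2)⁻¹ * (-(2 * (t * m) ^ 2)))
            + β * ((2 * Real.log 2)⁻¹ *
              (t * ∫ x, P₁ x * (w x - k) ^ 2 ∂c.μ - 2 * (t * m) ^ 2)) := by ring
      rw [this]
      linarith
    by_contra! hcon
    exact absurd k5 (not_le.2 (mul_pos hκ (mul_pos ht (sub_pos.2 hcon))))
  have hzero : ∫ x, P₁ x * (w x - k) ^ 2 ∂c.μ = 0 := by
    refine le_antisymm ?_ (integral_nonneg fun x => mul_nonneg (hP₁.2.1 x) (sq_nonneg _))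
    have hlim : Tendsto (fun t : ℝ => t * (2 * (α + β) * m ^ 2)) (𝓝[>] 0) (𝓝 0) := by
      have : Continuous fun t : ℝ => t * (2 * (α + β) * m ^ 2) := by fun_prop
      have h := this.tendsto 0
      rw [zero_mul] at h
      exact h.mono_left nhdsWithin_le_nhds
    have h : β * ∫ x, P₁ x * (w x - k) ^ 2 ∂c.μ ≤ 0 := by
      refine ge_of_tendsto hlim ?_
      filter_upwards [Ioc_mem_nhdsGT (show (0 : ℝ) < l₁ / 2 by positivity)] with t ht
      exact key t ht.1 ht.2
    by_contra! hcon
    exact absurd h (not_le.2 (mul_pos hβ hcon))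
  refine ⟨k, ?_⟩
  have hae := (integral_eq_zero_iff_of_nonneg
    (fun x => mul_nonneg (hP₁.2.1 x) (sq_nonneg _)) hsqi).1 hzero
  filter_upwards [hae, hwp] with x hx hwx hp
  rw [← hwx hp]
  have h : P₁ x * (w x - k) ^ 2 = 0 := hx
  rcases mul_eq_zero.1 h with h | h
  · exact absurd h hp.ne'
  · exact sub_eq_zero.1 (pow_eq_zero_iff two_ne_zero |>.1 h)

/-- An equilibrium payoff that maximizes a linear form favouring user 1 is the corner point of
user 1 or the sum-rate point. -/
theorem isCorner_or_isSumPoint {D : Set Ω} (hD : MeasurableSet D) {P₁ P₂ : Ω → ℝ}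
    (hNash : c.IsNash D P₁ P₂) {α β : ℝ} (hβ : 0 ≤ β) (hαβ : β ≤ α) (hα : 0 < α)
    (hmax : ∀ S ∈ c.region, α * S.1 + β * S.2
      ≤ α * c.payoff D P₁ P₂ + β * c.swap.payoff Dᶜ P₂ P₁) :
    c.IsCorner (c.payoff D P₁ P₂, c.swap.payoff Dᶜ P₂ P₁) ∨
      c.IsSumPoint (c.payoff D P₁ P₂, c.swap.payoff Dᶜ P₂ P₁) := by
  obtain ⟨hP₁, hP₂, hb1, hb2⟩ := hNash
  have hmem := c.payoff_mem_region hD hP₁ hP₂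
  have hadd := c.payoff_add_payoff hD hP₁ hP₂
  rcases hαβ.eq_or_lt with rfl | hlt
  · right
    refine ⟨hmem, fun S hS => ?_⟩
    have h := hmax S hS
    rw [← mul_add, ← mul_add] at h
    exact le_of_mul_le_mul_left h hα
  obtain ⟨l₁, hl₁, hB₁, hw₁⟩ := (c.bestResponse_iff hD hP₁ hP₂).1 hb1
  obtain ⟨l₂, hl₂, hB₂, hw₂⟩ := (c.swap.bestResponse_iff hD.compl hP₂ hP₁).1 hb2
  have hPB₁ : ∫ x, P₁ x ∂c.μ = c.B₁ := (integral_congr_ae hw₁).trans hB₁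
  have hPB₂ : ∫ x, P₂ x ∂c.μ = c.B₂ := (integral_congr_ae hw₂).trans hB₂
  have hsolo := c.payoff_le_soloRate hD hP₁ hP₂
  -- Payoffs with `D = ∅` lie in the region, and for them the linear form becomes a weighted sum of
  -- solo rate and sum rate.
  have hJ : ∀ Q₁ ∈ policies c.μ c.B₁, ∀ Q₂ ∈ policies c.μ c.B₂,
      (α - β) * c.soloRate Q₁ + β * c.sumRate Q₁ Q₂
        ≤ (α - β) * c.payoff D P₁ P₂ + β * c.sumRate P₁ P₂ := by
    intro Q₁ hQ₁ Q₂ hQ₂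
    have h := hmax _ (c.payoff_mem_region MeasurableSet.empty hQ₁ hQ₂)
    have h2 := c.payoff_add_payoff MeasurableSet.empty hQ₁ hQ₂
    simp only at h
    rw [payoff_empty] at h h2
    rw [← h2, ← hadd]
    linarith
  have hsolo_eq : c.payoff D P₁ P₂ = c.soloRate P₁ := by
    refine le_antisymm hsolo.1 ?_
    have h := hJ P₁ hP₁ P₂ hP₂
    exact le_of_mul_le_mul_left (by linarith) (sub_pos.2 hlt)
  have hexD := hsolo.2 hsolo_eq
  -- On `D` at most one user transmits, so the water-filling conditions take a form independent of
  -- `D`, the one belonging to the decoding order of `D = ∅`.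
  have hfacts : ∀ᵐ x ∂c.μ, l₁ * c.g₁ x ≤ c.N + (P₁ x * c.g₁ x + P₂ x * c.g₂ x) ∧
      l₂ * c.g₂ x ≤ c.N + (P₁ x * c.g₁ x + P₂ x * c.g₂ x) ∧
      (0 < P₁ x → c.N + P₁ x * c.g₁ x = l₁ * c.g₁ x) ∧
      (0 < P₂ x → c.N + (P₁ x * c.g₁ x + P₂ x * c.g₂ x) = l₂ * c.g₂ x) := by
    filter_upwards [hw₁, hw₂, c.g₁_pos, c.g₂_pos, hexD] with x h1 h2 ha hb hex
    have hp1 := mul_nonneg (hP₁.2.1 x) ha.le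
    have hp2 := mul_nonneg (hP₂.2.1 x) hb.le
    have a1 := level_le_of_waterFill (N := c.noise D P₂ x) (l := l₁) ha
    have a2 : l₂ * c.g₂ x ≤ c.swap.noise Dᶜ P₁ x
        + waterFill (c.swap.noise Dᶜ P₁ x) (c.g₂ x) l₂ * c.g₂ x := level_le_of_waterFill hb
    have a3 := level_eq_of_waterFill_pos (N := c.noise D P₂ x) (l := l₁) ha
    have a4 : 0 < waterFill (c.swap.noise Dᶜ P₁ x) (c.g₂ x) l₂ → c.swap.noise Dᶜ P₁ x
        + waterFill (c.swap.noise Dᶜ P₁ x) (c.g₂ x) l₂ * c.g₂ x = l₂ * c.g₂ x :=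
      level_eq_of_waterFill_pos hb
    have h2' : P₂ x = waterFill (c.swap.noise Dᶜ P₁ x) (c.g₂ x) l₂ := h2
    rw [← h1] at a1 a3
    rw [← h2'] at a2 a4
    by_cases hx : x ∈ D
    · have n1 : c.noise D P₂ x = c.N + P₂ x * c.g₂ x := c.noise_of_mem hx P₂
      have n2 : c.swap.noise Dᶜ P₁ x = c.N := c.swap.noise_of_notMem (by simpa using hx) P₁
      rw [n1] at a1 a3
      rw [n2] at a2 a4
      refine ⟨by linarith, by linarith, fun h => ?_, fun h => ?_⟩
      · have h0 : P₂ x = 0 := (hex hx).resolve_left h.ne'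
        have := a3 h
        rw [h0] at this
        linarith
      · have h0 : P₁ x = 0 := (hex hx).resolve_right h.ne'
        rw [h0]
        linarith [a4 h]
    · have n1 : c.noise D P₂ x = c.N := c.noise_of_notMem hx P₂
      have n2 : c.swap.noise Dᶜ P₁ x = c.N + P₁ x * c.g₁ x :=
        c.swap.noise_of_mem (by simpa using hx) P₁
      rw [n1] at a1 a3
      rw [n2] at a2 a4
      exact ⟨by linarith, by linarith, a3, fun h => by linarith [a4 h]⟩
  rcases hβ.eq_or_lt with rfl | hβ0
  · left
    have hnash : c.IsNash ∅ P₁ P₂ := by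
      refine ⟨hP₁, hP₂, fun Q hQ => ?_, ?_⟩
      · have h := hJ Q hQ P₂ hP₂
        rw [payoff_empty, payoff_empty, ← hsolo_eq]
        rw [zero_mul, zero_mul, add_zero, add_zero] at h
        exact le_of_mul_le_mul_left h (sub_pos.2 hlt)
      · have hw : ∀ᵐ x ∂c.swap.μ,
            P₂ x = waterFill (c.swap.noise (∅ : Set Ω)ᶜ P₁ x) (c.swap.g₁ x) l₂ := by
          filter_upwards [hfacts, c.g₂_pos] with x hx hb
          rw [noise_swap_univ]
          refine eq_waterFill hb (hP₂.2.1 x) ?_ ?_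
          · exact hx.2.1.trans_eq (add_assoc _ _ _).symm
          · intro h
            exact (add_assoc _ _ _).trans (hx.2.2.2 h)
        exact (c.swap.bestResponse_iff MeasurableSet.empty.compl hP₂ hP₁).2
          ⟨l₂, hl₂, (integral_congr_ae hw).symm.trans hPB₂, hw⟩
    refine (c.isCorner_iff_nash _).2 ⟨P₁, P₂, hnash, ?_⟩
    have h2 := c.payoff_add_payoff MeasurableSet.empty hP₁ hP₂
    rw [payoff_empty] at h2
    ext
    · rw [payoff_empty]
      exact hsolo_eq
    · simp only
      linarith
  · right
    have hle : ∀ᵐ x ∂c.μ, P₁ x ≤ l₁ := by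
      filter_upwards [hw₁, c.le_noise D hP₂.2.1] with x hx hn
      rw [hx]
      exact waterFill_le (c.N_pos.le.trans hn) hl₁.le
    obtain ⟨k, hk⟩ := c.marginal_const hP₁ hP₂ hl₁ (sub_nonneg.2 hlt.le) hβ0 hPB₁ hle
      (hfacts.mono fun x hx => hx.2.2.1) (fun Q hQ => by
        have h := hJ Q hQ P₂ hP₂
        rwa [hsolo_eq] at h)
    -- If both transmit, the total level is `l₂ g₂`, so `g₁ = k l₂ g₂`, a null event. When `k l₂ ≤
    -- 0` user 1 cannot transmit at all, since its marginal `k` would be positive.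
    have hex : ∀ᵐ x ∂c.μ, 0 < P₁ x → P₂ x = 0 := by
      by_cases hkl : 0 < k * l₂
      · filter_upwards [hk, hfacts, c.g₁_pos, c.g₂_pos, c.no_tie 1 (k * l₂) one_pos hkl]
          with x hkx hx ha hb htie hp
        by_contra hne
        have hp2 : 0 < P₂ x := lt_of_le_of_ne (hP₂.2.1 x) (Ne.symm hne)
        have h1 := hkx hp
        rw [hx.2.2.2 hp2, div_eq_iff (by positivity)] at h1
        exact htie (by linarith)
      · filter_upwards [hk, hfacts, c.g₁_pos, c.g₂_pos] with x hkx hx ha hb hp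
        have hp2 := hP₂.2.1 x
        have hN := c.N_pos
        have h1 : 0 < k := by
          rw [← hkx hp]
          positivity
        exact absurd (mul_pos h1 hl₂) hkl
    have hK : c.SumKKT l₁ l₂ P₁ P₂ := by
      filter_upwards [hfacts, hex] with x hx he
      refine ⟨hx.1, hx.2.1, fun h => ?_, hx.2.2.2⟩
      rw [he h, zero_mul, add_zero]
      exact hx.2.2.1 h
    refine ⟨hmem, ?_⟩
    rintro S ⟨Q₁, hQ₁, Q₂, hQ₂, -, -, -, -, h⟩
    refine h.trans (((c.sumRate_le_of_sumKKT hl₁ hl₂ hP₁ hP₂ hQ₁ hQ₂ hPB₁ hPB₂ hK).1).trans_eq ?_)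
    exact hadd.symm

theorem isSumPoint_swap {R : ℝ × ℝ} (h : c.swap.IsSumPoint R) : c.IsSumPoint R.swap := by
  refine ⟨c.mem_region_swap h.1, fun S hS => ?_⟩
  have := h.2 _ (c.swap_mem_region hS)
  simp only [Prod.fst_swap, Prod.snd_swap] at this ⊢
  linarith

/-- Equilibrium payoffs on the boundary of the region are corner points or the sum-rate point. -/
theorem nash_mem_frontier {D : Set Ω} (hD : MeasurableSet D) {P₁ P₂ : Ω → ℝ}
    (hNash : c.IsNash D P₁ P₂)
    (hfr : (c.payoff D P₁ P₂, c.swap.payoff Dᶜ P₂ P₁) ∈ frontier c.region) :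
    c.IsCorner (c.payoff D P₁ P₂, c.swap.payoff Dᶜ P₂ P₁) ∨
      c.swap.IsCorner (c.swap.payoff Dᶜ P₂ P₁, c.payoff D P₁ P₂) ∨
      c.IsSumPoint (c.payoff D P₁ P₂, c.swap.payoff Dᶜ P₂ P₁) := by
  have hpos := c.nash_payoff_pos hD hNash
  obtain ⟨α, β, hα, hβ, hαβ, hmax⟩ := exists_maximal_of_mem_frontier c.convex_region
    (fun S hS T => c.region_down hS T) (c.payoff_mem_region hD hNash.1 hNash.2.1)
    hpos.1 hpos.2 hfr
  rcases le_total β α with h | h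
  · rcases c.isCorner_or_isSumPoint hD hNash hβ h (by linarith) hmax with h | h
    · exact Or.inl h
    · exact Or.inr (Or.inr h)
  · have e : c.swap.swap.payoff Dᶜᶜ P₁ P₂ = c.payoff D P₁ P₂ := by
      rw [compl_compl]
      rfl
    have h2 := c.swap.isCorner_or_isSumPoint hD.compl (c.isNash_swap hNash) hα h (by linarith)
      (fun S hS => by
        have := hmax _ (c.mem_region_swap hS)
        rw [e]
        simp only [Prod.fst_swap, Prod.snd_swap] at this
        linarith)
    rw [e] at h2
    rcases h2 with h | h
    · exact Or.inr (Or.inl h)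
    · exact Or.inr (Or.inr (c.isSumPoint_swap h))

end TwoUserChannel

namespace FadingMAC

/-! ### The fading channel as an abstract two-user channel -/

/-- A proper linear subspace is Lebesgue-null. Besides excluding ties, the cases with one zero
coefficient make both gains a.e. positive. -/
theorem volume_line_eq_zero {s t : ℝ} (h : s ≠ 0 ∨ t ≠ 0) :
    (volume : Measure (ℝ × ℝ)) {x | s * x.1 = t * x.2} = 0 := by
  set L : ℝ × ℝ →ₗ[ℝ] ℝ := s • LinearMap.fst ℝ ℝ ℝ - t • LinearMap.snd ℝ ℝ ℝ with hL
  have hker : ({x | s * x.1 = t * x.2} : Set (ℝ × ℝ)) = LinearMap.ker L := by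
    ext x
    simp [hL, sub_eq_zero]
  rw [hker]
  refine Measure.addHaar_submodule _ _ fun htop => ?_
  rw [LinearMap.ker_eq_top] at htop
  have h1 := LinearMap.congr_fun htop (1, 0)
  have h2 := LinearMap.congr_fun htop (0, 1)
  simp only [hL, LinearMap.sub_apply, LinearMap.smul_apply, LinearMap.fst_apply,
    LinearMap.snd_apply, smul_eq_mul, mul_one, mul_zero, sub_zero, zero_sub, LinearMap.zero_apply,
    neg_eq_zero] at h1 h2
  exact h.elim (fun h => h h1) (fun h => h h2)

theorem law_line_ae (M : FadingMAC) {s t : ℝ} (h : s ≠ 0 ∨ t ≠ 0) :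
    ∀ᵐ x ∂M.law, s * x.1 ≠ t * x.2 := by
  have hac : M.law ≪ volume := withDensity_absolutelyContinuous _ _
  refine hac.ae_le (measure_eq_zero_iff_ae_notMem.1 (volume_line_eq_zero h))

theorem law_nonneg_ae (M : FadingMAC) : ∀ᵐ x ∂M.law, 0 ≤ x.1 ∧ 0 ≤ x.2 := by
  have hm : Measurable fun h => ENNReal.ofReal (M.f h) := M.f_measurable.ennreal_ofReal
  unfold law
  rw [ae_withDensity_iff hm]
  refine Eventually.of_forall fun x hx => ?_
  by_contra hcon
  refine hx ?_
  rw [M.f_supp x, ENNReal.ofReal_zero]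
  by_contra! h
  exact hcon h

/-- The abstract two-user channel of a fading channel. -/
noncomputable def channel (M : FadingMAC) : TwoUserChannel (ℝ × ℝ) where
  μ := M.law
  prob := ⟨by rw [law, withDensity_apply _ MeasurableSet.univ, Measure.restrict_univ, M.f_total]⟩
  N := M.σ ^ 2
  N_pos := pow_pos M.σ_pos 2
  g₁ := fun h => h.1
  g₂ := fun h => h.2
  B₁ := M.Pbar₁
  B₂ := M.Pbar₂
  B₁_pos := M.Pbar₁_pos
  B₂_pos := M.Pbar₂_pos
  measurable_g₁ := measurable_fst
  measurable_g₂ := measurable_snd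
  g₁_pos := by
    filter_upwards [M.law_nonneg_ae, M.law_line_ae (s := 1) (t := 0) (Or.inl one_ne_zero)]
      with x h1 h2
    exact lt_of_le_of_ne h1.1 fun h => h2 (by rw [← h]; ring)
  g₂_pos := by
    filter_upwards [M.law_nonneg_ae, M.law_line_ae (s := 0) (t := 1) (Or.inr one_ne_zero)]
      with x h1 h2
    exact lt_of_le_of_ne h1.2 fun h => h2 (by rw [← h]; ring)
  log_g₁ := M.log_gain₁
  log_g₂ := M.log_gain₂
  no_tie := fun _ _ hs _ => M.law_line_ae (Or.inl hs.ne')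

theorem isCornerPoint₂_iff (M : FadingMAC) (R : ℝ × ℝ) :
    M.IsCornerPoint₂ R ↔ M.channel.swap.IsCorner R.swap := by
  constructor
  · rintro ⟨l₁, l₂, P₁, P₂, h1, h2, h3, h4, rfl⟩
    exact ⟨l₂, l₁, P₂, P₁, h1, h2, h4, h3, rfl⟩
  · rintro ⟨l₂, l₁, P₂, P₁, h1, h2, h4, h3, h5⟩
    refine ⟨l₁, l₂, P₁, P₂, h1, h2, h3, h4, ?_⟩
    rw [← Prod.swap_swap R, h5]
    rfl

theorem ratePair_eq (M : FadingMAC) (D : Set (ℝ × ℝ)) (P₁ P₂ : ℝ × ℝ → ℝ) :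
    M.ratePair D P₁ P₂ = (M.channel.payoff D P₁ P₂, M.channel.swap.payoff Dᶜ P₂ P₁) := rfl

/-- An equilibrium with the same payoffs as every other one is admissible. -/
theorem mem_stackelbergRegion_of_unique (M : FadingMAC) {D : Set (ℝ × ℝ)} (hD : MeasurableSet D)
    {P₁ P₂ : ℝ × ℝ → ℝ} (h : M.IsNash D P₁ P₂)
    (huniq : ∀ Q₁ Q₂, M.IsNash D Q₁ Q₂ → M.ratePair D Q₁ Q₂ = M.ratePair D P₁ P₂) :
    M.ratePair D P₁ P₂ ∈ M.stackelbergRegion := by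
  refine ⟨D, hD, P₁, P₂, ⟨h, ?_⟩, rfl⟩
  rintro ⟨Q₁, Q₂, hQ, -, -, hlt⟩
  have he := huniq Q₁ Q₂ hQ
  simp only [ratePair, Prod.mk.injEq] at he
  rcases hlt with hlt | hlt <;> linarith [he.1, he.2]

theorem corner₁_mem_stackelbergRegion (M : FadingMAC) {C : ℝ × ℝ} (hC : M.IsCornerPoint₁ C) :
    C ∈ M.stackelbergRegion := by
  obtain ⟨P₁, P₂, hP, rfl⟩ := (M.channel.isCorner_iff_nash C).1 hC
  refine M.mem_stackelbergRegion_of_unique MeasurableSet.empty hP fun Q₁ Q₂ hQ => ?_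
  have h := M.channel.nash_empty_unique hQ hP
  rw [ratePair_eq, ratePair_eq, h.1, h.2]

theorem corner₂_mem_stackelbergRegion (M : FadingMAC) {C : ℝ × ℝ} (hC : M.IsCornerPoint₂ C) :
    C ∈ M.stackelbergRegion := by
  obtain ⟨P₂, P₁, hP, hCe⟩ := (M.channel.swap.isCorner_iff_nash _).1 ((M.isCornerPoint₂_iff C).1 hC)
  have e : C = M.ratePair ∅ᶜ P₁ P₂ := by
    rw [← Prod.swap_swap C, hCe, ratePair_eq, compl_compl]
    rfl
  rw [e]
  refine M.mem_stackelbergRegion_of_unique MeasurableSet.empty.compl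
    (M.channel.swap.isNash_swap hP) fun Q₁ Q₂ hQ => ?_
  have hQ' : M.channel.swap.IsNash ∅ Q₂ Q₁ := by
    have := M.channel.isNash_swap hQ
    rwa [compl_compl] at this
  have h := M.channel.swap.nash_empty_unique hQ' hP
  rw [ratePair_eq, ratePair_eq, compl_compl, h.1]
  exact congrArg (fun r => (r, _)) h.2

/-- A dominating equilibrium would have a strictly larger sum of payoffs while still lying in the
region. -/
theorem sumRatePoint_mem_stackelbergRegion (M : FadingMAC) {D : Set (ℝ × ℝ)}
    (hD : MeasurableSet D) {P₁ P₂ : ℝ × ℝ → ℝ} (h : M.IsNash D P₁ P₂)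
    (hS : M.IsSumRatePoint (M.ratePair D P₁ P₂)) :
    M.ratePair D P₁ P₂ ∈ M.stackelbergRegion := by
  refine ⟨D, hD, P₁, P₂, ⟨h, ?_⟩, rfl⟩
  rintro ⟨Q₁, Q₂, hQ, h1, h2, hlt⟩
  have hmax : M.payoff₁ D Q₁ Q₂ + M.payoff₂ D Q₁ Q₂ ≤ M.payoff₁ D P₁ P₂ + M.payoff₂ D P₁ P₂ :=
    hS.2 _ (M.channel.payoff_mem_region hD hQ.1 hQ.2.1)
  rcases hlt with hlt | hlt <;> linarith

end FadingMAC

/-! ### The main theorem -/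

theorem mainTheorem2 (M : FadingMAC) :
    ∃ CR₁ CR₂ SP : ℝ × ℝ,
      (∀ R, M.IsCornerPoint₁ R ↔ R = CR₁) ∧
      (∀ R, M.IsCornerPoint₂ R ↔ R = CR₂) ∧
      (∀ R, M.IsSumRatePoint R ↔ R = SP) ∧
      CR₁ ∈ frontier M.capacityRegion ∧ CR₂ ∈ frontier M.capacityRegion ∧
      SP ∈ frontier M.capacityRegion ∧
      CR₁ ∈ M.stackelbergRegion ∧ CR₂ ∈ M.stackelbergRegion ∧ SP ∈ M.stackelbergRegion ∧
      ∀ R ∈ M.stackelbergRegion, R ∈ frontier M.capacityRegion →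
        R = CR₁ ∨ R = CR₂ ∨ R = SP := by
  obtain ⟨C₁, hC₁⟩ := M.channel.exists_unique_corner
  obtain ⟨C₂, hC₂⟩ := M.channel.swap.exists_unique_corner
  obtain ⟨S, hS, D, hD, P₁, P₂, hP, hSP⟩ := M.channel.exists_unique_sumPoint
  -- The notions for the fading channel unfold definitionally to those of `M.channel`; only `CR₂`
  -- needs its coordinates exchanged.
  have h₁ : ∀ R, M.IsCornerPoint₁ R ↔ R = C₁ := hC₁
  have h₂ : ∀ R, M.IsCornerPoint₂ R ↔ R = C₂.swap := by
    intro R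
    rw [M.isCornerPoint₂_iff, hC₂]
    constructor
    · intro h
      rw [← h, Prod.swap_swap]
    · intro h
      rw [h, Prod.swap_swap]
  have h₃ : ∀ R, M.IsSumRatePoint R ↔ R = S := hS
  have hc₁ : M.channel.IsCorner C₁ := (hC₁ _).2 rfl
  have hc₂ : M.channel.swap.IsCorner C₂ := (hC₂ _).2 rfl
  have hs : M.IsSumRatePoint S := (h₃ S).2 rfl
  refine ⟨C₁, C₂.swap, S, h₁, h₂, h₃, ?_, ?_, ?_, ?_, ?_, ?_, ?_⟩
  · refine mem_frontier_of_maximal (α := 1) (β := 0) (M.channel.corner_mem_region hc₁)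
      (by norm_num) fun T hT => ?_
    have := M.channel.fst_le_corner hc₁ hT
    linarith
  · refine mem_frontier_of_maximal (α := 0) (β := 1)
      (M.channel.mem_region_swap (M.channel.swap.corner_mem_region hc₂)) (by norm_num)
      fun T hT => ?_
    have := M.channel.swap.fst_le_corner hc₂ (M.channel.swap_mem_region hT)
    simp only [Prod.fst_swap, Prod.snd_swap] at this ⊢
    linarith
  · refine mem_frontier_of_maximal (α := 1) (β := 1) hs.1 (by norm_num) fun T hT => ?_
    have := hs.2 T hT
    linarith
  · exact M.corner₁_mem_stackelbergRegion ((h₁ _).2 rfl)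
  · exact M.corner₂_mem_stackelbergRegion ((h₂ _).2 rfl)
  · have e : S = M.ratePair D P₁ P₂ := hSP
    rw [e] at hs ⊢
    exact M.sumRatePoint_mem_stackelbergRegion hD hP hs
  · rintro R ⟨D, hD, P₁, P₂, ⟨hN, -⟩, rfl⟩ hfr
    rcases M.channel.nash_mem_frontier hD hN hfr with h | h | h
    · exact Or.inl ((hC₁ _).1 h)
    · exact Or.inr (Or.inl ((h₂ _).1 ((M.isCornerPoint₂_iff _).2 h)))
    · exact Or.inr (Or.inr ((hS _).1 h))
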